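/- A two-qubit state is a positive semidefinite complex matrix $\rho$ of trace $1$ on $\mathbb C^2\otimes\mathbb C^2$; $\rho^\Gamma$ is its partial transpose with respect to the second qubit, and $\rho$ is separable if it is a convex combination of product states $\alpha\otimes\beta$. Let $F(\rho)=\max_\psi\langle\psi|\rho|\psi\rangle$, the maximum over all maximally entangled unit vectors $\psi\in\mathbb C^2\otimes\mathbb C^2$, and let $F^*(\rho)=\sup_\Lambda F(\Lambda(\rho))$, the supremum over all trace-preserving LOCC operations $\Lambda$ from two qubits to two qubits (finitely many rounds of local measurements with finitely many outcomes, with classical communication of the outcomes; intermediate local systems of arbitrary finite dimension are allowed). Theorem. For every two-qubit state $\rho$ the supremum $F^*(\rho)$ is attained, and all of the following hold. 1. (Duality) $F^*(\rho)$ is the maximum of $\tfrac12-\mathrm{tr}(X\rho^\Gamma)$ over matrices $X$ with $0\le X\le I_4$ and $-\tfrac12 I_4\le X^\Gamma\le\tfrac12 I_4$, and it is the minimum of $\tfrac12+\tfrac12\mathrm{tr}(Z)$ over matrices $Z\ge 0$ with $(\rho+Z)^\Gamma\ge 0$. 2. (Minimal mixing) $F^*(\rho)$ is the minimum of $\frac1{2(1-p)}$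 over all $0\le p<1$ and all states $\rho_Z$ such that $(1-p)\rho+p\rho_Z$ is separable. Equivalently, there is a smallest $p\in[0,1)$ for which $(1-p)\rho+p\rho_Z$ is separable for some state $\rho_Z$, and $F^*(\rho)=\frac1{2(1-p)}$ for this $p$. 3. (Entanglement measure) $F^*(\rho)\ge\tfrac12$, with equality if and only if $\rho$ is separable; $F^*(\Lambda(\rho))\le F^*(\rho)$ for every trace-preserving LOCC operation $\Lambda$ from two qubits to two qubits; if an LOCC measurement from two qubits to two qubits turns $\rho$ into the states $\rho_i$ with probabilities $p_i$, then $\sum_i p_iF^*(\rho_i)\le F^*(\rho)$; and $F^*$ is convex on the set of two-qubit states. -/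

import Mathlib

open scoped Kronecker Matrix ComplexOrder

noncomputable section

namespace TwoQubit

/-- Operators on the bipartite space `ℂᵃ ⊗ ℂᵇ`, in the product basis. -/
abbrev Op (a b : ℕ) : Type := Matrix (Fin a × Fin b) (Fin a × Fin b) ℂ

/-- Density matrices: positive semidefinite with unit trace. -/
def IsState {n : Type} [Fintype n] (ρ : Matrix n n ℂ) : Prop :=
  ρ.PosSemidef ∧ ρ.trace = 1

/-- Partial transpose `ρ^Γ` with respect to the second system. -/
def partialTranspose (ρ : Op 2 2) : Op 2 2 :=
  Matrix.of fun x y => ρ (x.1, y.2) (y.1, x.2)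

/-- Partial trace over the second system. -/
def partialTraceB (ρ : Op 2 2) : Matrix (Fin 2) (Fin 2) ℂ :=
  Matrix.of fun i k => ∑ j, ρ (i, j) (k, j)

/-- Separable states: convex combinations of product states. -/
def IsSeparable (ρ : Op 2 2) : Prop :=
  ρ ∈ convexHull ℝ
    {τ : Op 2 2 | ∃ α β : Matrix (Fin 2) (Fin 2) ℂ, IsState α ∧ IsState β ∧ τ = α ⊗ₖ β}

/-- Maximally entangled vectors: the reduced state of `|ψ⟩⟨ψ|` is maximally mixed
(this includes the normalisation of `ψ`). -/
def IsMaximallyEntangled (ψ : Fin 2 × Fin 2 → ℂ) : Prop :=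
  partialTraceB (Matrix.vecMulVec ψ (star ψ)) = (1 / 2 : ℂ) • 1

/-- Maximal singlet fraction `F(ρ)`: the maximum of `⟨ψ|ρ|ψ⟩` over maximally entangled `ψ`. -/
def fidelity (ρ : Op 2 2) : ℝ :=
  sSup {x : ℝ | ∃ ψ, IsMaximallyEntangled ψ ∧ x = (star ψ ⬝ᵥ (ρ *ᵥ ψ)).re}

/-- LOCC protocols with finitely many rounds that start on `ℂᵃ ⊗ ℂᵇ` and end on two qubits.
In each round one party performs a complete measurement with finitely many Kraus operators (the
dimension of the post-measurement system may depend on the outcome) and broadcasts the outcome,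
which determines the rest of the protocol. At the end an outcome label in `ι` is recorded. -/
inductive LOCC (ι : Type) : ℕ → ℕ → Type
  | done (i : ι) : LOCC ι 2 2
  | alice {a b r : ℕ} (c : Fin r → ℕ) (K : (k : Fin r) → Matrix (Fin (c k)) (Fin a) ℂ)
      (complete : ∑ k, (K k)ᴴ * K k = 1) (next : (k : Fin r) → LOCC ι (c k) b) : LOCC ι a b
  | bob {a b r : ℕ} (c : Fin r → ℕ) (K : (k : Fin r) → Matrix (Fin (c k)) (Fin b) ℂ)
      (complete : ∑ k, (K k)ᴴ * K k = 1) (next : (k : Fin r) → LOCC ι a (c k)) : LOCC ι a b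

/-- The unnormalised final state conditioned on the recorded label `i`; its trace is the
probability of `i`. -/
def LOCC.branch {ι : Type} [DecidableEq ι] (i : ι) : {a b : ℕ} → LOCC ι a b → Op a b → Op 2 2
  | _, _, .done j, ρ => if j = i then ρ else 0
  | _, _, .alice (b := b) _ K _ next, ρ =>
      ∑ k, (next k).branch i
        ((K k ⊗ₖ (1 : Matrix (Fin b) (Fin b) ℂ)) * ρ *
          (K k ⊗ₖ (1 : Matrix (Fin b) (Fin b) ℂ))ᴴ)
  | _, _, .bob (a := a) _ K _ next, ρ =>
      ∑ k, (next k).branch i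
        (((1 : Matrix (Fin a) (Fin a) ℂ) ⊗ₖ K k) * ρ *
          ((1 : Matrix (Fin a) (Fin a) ℂ) ⊗ₖ K k)ᴴ)

/-- The trace-preserving LOCC operation on two qubits implemented by a protocol that records
only the trivial label, i.e. that forgets all measurement outcomes at the end. -/
def LOCC.channel (P : LOCC Unit 2 2) (ρ : Op 2 2) : Op 2 2 := P.branch () ρ

/-- The fidelities that are achievable from `ρ` by trace-preserving LOCC operations. -/
def achievableFidelities (ρ : Op 2 2) : Set ℝ :=
  {x : ℝ | ∃ P : LOCC Unit 2 2, x = fidelity (P.channel ρ)}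

/-- `F*(ρ)`: the maximal fidelity achievable by trace-preserving LOCC operations. -/
def Fstar (ρ : Op 2 2) : ℝ := sSup (achievableFidelities ρ)

/-- The values of the primal program: `1/2 - tr(X ρ^Γ)` with `0 ≤ X ≤ I` and
`-I/2 ≤ X^Γ ≤ I/2`. -/
def primalValues (ρ : Op 2 2) : Set ℝ :=
  {x : ℝ | ∃ X : Op 2 2, X.PosSemidef ∧ (1 - X).PosSemidef ∧
    (partialTranspose X + (1 / 2 : ℂ) • 1).PosSemidef ∧
    ((1 / 2 : ℂ) • 1 - partialTranspose X).PosSemidef ∧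
    x = 1 / 2 - (X * partialTranspose ρ).trace.re}

/-- The values of the dual program: `1/2 + tr(Z)/2` with `Z ≥ 0` and `(ρ + Z)^Γ ≥ 0`. -/
def dualValues (ρ : Op 2 2) : Set ℝ :=
  {x : ℝ | ∃ Z : Op 2 2, Z.PosSemidef ∧ (partialTranspose (ρ + Z)).PosSemidef ∧
    x = 1 / 2 + Z.trace.re / 2}

/-- The weights `0 ≤ p < 1` such that mixing `ρ` with some state of weight `p` gives a
separable state. -/
def disentanglingWeights (ρ : Op 2 2) : Set ℝ :=
  {p : ℝ | 0 ≤ p ∧ p < 1 ∧ ∃ ρZ : Op 2 2, IsState ρZ ∧ IsSeparable ((1 - p) • ρ + p • ρZ)}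

/-- `E` is an entanglement measure (a faithful convex entanglement monotone) on two-qubit states,
with minimal value `c`. -/
structure IsEntanglementMeasure (c : ℝ) (E : Op 2 2 → ℝ) : Prop where
  /-- `c` is a lower bound. -/
  le : ∀ ρ, IsState ρ → c ≤ E ρ
  /-- The value `c` is attained at the separable states, and only there. -/
  eq_iff : ∀ ρ, IsState ρ → (E ρ = c ↔ IsSeparable ρ)
  /-- `E` does not increase under trace-preserving LOCC operations. -/
  monotone : ∀ ρ, IsState ρ → ∀ P : LOCC Unit 2 2, E (P.channel ρ) ≤ E ρ
  /-- `E` does not increase on average under LOCC measurements: `∑ i, pᵢ E(ρᵢ) ≤ E(ρ)`, with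
  `pᵢ` the probability of outcome `i` and `ρᵢ` the normalised conditional state
  (an outcome of probability zero contributes zero). -/
  monotone_average : ∀ ρ, IsState ρ → ∀ (m : ℕ) (P : LOCC (Fin m) 2 2),
    ∑ i, (P.branch i ρ).trace.re * E ((P.branch i ρ).trace.re⁻¹ • P.branch i ρ) ≤ E ρ
  /-- `E` does not increase under mixing. -/
  convex : ConvexOn ℝ {ρ : Op 2 2 | IsState ρ} E

end TwoQubit

end

open scoped Kronecker Matrix ComplexOrder

noncomputable section

namespace TwoQubit

/-! Everything is reduced to one optimisation over contractions `A` on `ℂ²`, read as vectors `|A⟩`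
through their coefficients.

Upper bound: if `Z ≥ 0` and `(ρ + Z)^Γ ≥ 0`, an LOCC protocol preserves both properties and the
trace of `Z`. A maximally entangled vector is `|A⟩/√2` with `A` unitary, and `|A⟩⟨A|^Γ ≤ 1`; pairing
this with the partial transpose of the output bounds its fidelity by `1/2 + tr(Z)/2`
(`IsMaximallyEntangled.form_le`).

Lower bound: Alice filters with a rotated `Aᴴ`, and both parties prepare `|00⟩` on failure. The
fidelity with `bell` is then `1/2 - ⟨A|ρ^Γ|A⟩/2` (`exists_protocol`), which is also the primal value
at `X = |A⟩⟨A|/2`.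

The bounds meet (`exists_filter_and_dual`). At a minimiser `A` of `⟨A|ρ^Γ|A⟩`, first-order
optimality makes `A` the isometric part of a polar decomposition of `H = -ρ^Γ|A⟩`. The positive part
yields a `Z ≥ 0` with `(ρ + Z)^Γ|A⟩ = 0` and matching trace. When the minimum is negative, `|A⟩` is
entangled, so every vector is a product vector plus a multiple of `|A⟩`, and `(ρ + Z)^Γ ≥ 0` follows
because partial transposes of positive operators are nonnegative on product vectors.

Minimal mixing is the dual program after normalising `Z`, by the Peres–Horodecki criterion. That
criterion is proved with Krein–Milman: an extreme point of the states with positive partial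
transpose has a product vector in its kernel, since otherwise a dimension count gives a direction in
which it can be moved both ways. -/

/-! ### Partial transposition and trace pairings. -/

/-- The partial transpose with respect to the second system, in arbitrary dimensions. -/
def pT {a b : ℕ} (ρ : Op a b) : Op a b :=
  Matrix.of fun x y => ρ (x.1, y.2) (y.1, x.2)

theorem partialTranspose_eq_pT (ρ : Op 2 2) : partialTranspose ρ = pT ρ := rfl

@[simp] theorem pT_apply {a b : ℕ} (ρ : Op a b) (x y : Fin a × Fin b) :
    pT ρ x y = ρ (x.1, y.2) (y.1, x.2) := rfl

@[simp] theorem pT_pT {a b : ℕ} (ρ : Op a b) : pT (pT ρ) = ρ := rfl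

theorem pT_add {a b : ℕ} (ρ σ : Op a b) : pT (ρ + σ) = pT ρ + pT σ := rfl

theorem pT_smul {a b : ℕ} (c : ℝ) (ρ : Op a b) : pT (c • ρ) = c • pT ρ := rfl

theorem pT_sum {a b : ℕ} {ι : Type*} (s : Finset ι) (f : ι → Op a b) :
    pT (∑ i ∈ s, f i) = ∑ i ∈ s, pT (f i) := by
  ext x y
  simp [Matrix.sum_apply]

theorem trace_pT {a b : ℕ} (ρ : Op a b) : (pT ρ).trace = ρ.trace := rfl

theorem isHermitian_pT {a b : ℕ} {ρ : Op a b} (h : ρ.IsHermitian) : (pT ρ).IsHermitian := by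
  ext x y
  simp only [Matrix.conjTranspose_apply, pT_apply]
  exact h.apply _ _

/-- Partial transposition turns a local conjugation into a local conjugation, with the second factor
complex conjugated. This is why local operations preserve positivity of the partial transpose. -/
theorem pT_conj {a b c d : ℕ} (K : Matrix (Fin c) (Fin a) ℂ) (L : Matrix (Fin d) (Fin b) ℂ)
    (ρ : Op a b) :
    pT ((K ⊗ₖ L) * ρ * (K ⊗ₖ L)ᴴ) = (K ⊗ₖ L.map star) * pT ρ * (K ⊗ₖ L.map star)ᴴ := by
  ext ⟨i, j⟩ ⟨k, l⟩
  simp only [pT_apply, Matrix.mul_apply, Matrix.kroneckerMap_apply, Matrix.conjTranspose_apply,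
    Fintype.sum_prod_type, Finset.sum_mul, Matrix.map_apply, star_mul', star_star]
  refine Finset.sum_congr rfl fun k' _ => ?_
  calc _ = ∑ l', ∑ j', ∑ i', K i i' * L l j' * ρ (i', j') (k', l') *
            (star (K k k') * star (L j l')) :=
        Finset.sum_congr rfl fun _ _ => Finset.sum_comm
    _ = ∑ j', ∑ l', ∑ i', K i i' * L l j' * ρ (i', j') (k', l') *
            (star (K k k') * star (L j l')) := Finset.sum_comm
    _ = ∑ j', ∑ i', ∑ l', K i i' * L l j' * ρ (i', j') (k', l') *
            (star (K k k') * star (L j l')) :=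
        Finset.sum_congr rfl fun _ _ => Finset.sum_comm
    _ = _ := Finset.sum_congr rfl fun _ _ => Finset.sum_congr rfl fun _ _ =>
        Finset.sum_congr rfl fun _ _ => by ring

theorem trace_pT_mul_pT {a b : ℕ} (ρ σ : Op a b) : (pT ρ * pT σ).trace = (ρ * σ).trace := by
  simp only [Matrix.trace, Matrix.diag, Matrix.mul_apply, pT_apply, Fintype.sum_prod_type]
  refine Finset.sum_congr rfl fun i _ => ?_
  calc _ = ∑ k, ∑ j, ∑ l, ρ (i, l) (k, j) * σ (k, j) (i, l) := Finset.sum_comm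
    _ = ∑ k, ∑ l, ∑ j, ρ (i, l) (k, j) * σ (k, j) (i, l) :=
        Finset.sum_congr rfl fun _ _ => Finset.sum_comm
    _ = _ := Finset.sum_comm

open scoped MatrixOrder in
theorem exists_eq_conjTranspose_mul_self {n : Type*} [Fintype n] [DecidableEq n]
    {P : Matrix n n ℂ} (hP : P.PosSemidef) : ∃ B : Matrix n n ℂ, P = Bᴴ * B :=
  CStarAlgebra.nonneg_iff_eq_star_mul_self.mp hP.nonneg

theorem trace_mul_nonneg {n : Type*} [Fintype n] [DecidableEq n] {P Q : Matrix n n ℂ}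
    (hP : P.PosSemidef) (hQ : Q.PosSemidef) : 0 ≤ (P * Q).trace := by
  obtain ⟨B, rfl⟩ := exists_eq_conjTranspose_mul_self hP
  rw [mul_assoc, Matrix.trace_mul_comm]
  exact (hQ.mul_mul_conjTranspose_same B).trace_nonneg

/-! ### What LOCC protocols preserve: sums, positivity, positive partial transpose, total trace. -/

section LOCC

variable {ι : Type} [DecidableEq ι]

theorem LOCC.branch_add (i : ι) {a b : ℕ} (P : LOCC ι a b) (ρ σ : Op a b) :
    P.branch i (ρ + σ) = P.branch i ρ + P.branch i σ := by
  induction P with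
  | done j => simp only [LOCC.branch]; split_ifs <;> simp
  | alice c K hK next ih =>
    simp only [LOCC.branch, Matrix.mul_add, Matrix.add_mul, ih, Finset.sum_add_distrib]
  | bob c K hK next ih =>
    simp only [LOCC.branch, Matrix.mul_add, Matrix.add_mul, ih, Finset.sum_add_distrib]

theorem LOCC.posSemidef_branch (i : ι) {a b : ℕ} (P : LOCC ι a b) {ρ : Op a b}
    (h : ρ.PosSemidef) : (P.branch i ρ).PosSemidef := by
  induction P with
  | done j =>
    simp only [LOCC.branch]
    split_ifs
    exacts [h, Matrix.PosSemidef.zero]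
  | alice c K hK next ih =>
    simp only [LOCC.branch]
    exact Matrix.posSemidef_sum _ fun k _ => ih k (h.mul_mul_conjTranspose_same _)
  | bob c K hK next ih =>
    simp only [LOCC.branch]
    exact Matrix.posSemidef_sum _ fun k _ => ih k (h.mul_mul_conjTranspose_same _)

theorem LOCC.posSemidef_pT_branch (i : ι) {a b : ℕ} (P : LOCC ι a b) {ρ : Op a b}
    (h : (pT ρ).PosSemidef) : (pT (P.branch i ρ)).PosSemidef := by
  induction P with
  | done j =>
    simp only [LOCC.branch]
    split_ifs
    exacts [h, Matrix.PosSemidef.zero]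
  | alice c K hK next ih =>
    simp only [LOCC.branch, pT_sum]
    refine Matrix.posSemidef_sum _ fun k _ => ih k ?_
    rw [pT_conj]
    exact h.mul_mul_conjTranspose_same _
  | bob c K hK next ih =>
    simp only [LOCC.branch, pT_sum]
    refine Matrix.posSemidef_sum _ fun k _ => ih k ?_
    rw [pT_conj]
    exact h.mul_mul_conjTranspose_same _

theorem LOCC.sum_trace_branch [Fintype ι] {a b : ℕ} (P : LOCC ι a b) (ρ : Op a b) :
    ∑ i, (P.branch i ρ).trace = ρ.trace := by
  induction P with
  | done j =>
    simp only [LOCC.branch]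
    rw [Finset.sum_eq_single j] <;> simp +contextual [eq_comm]
  | @alice a b r c K hK next ih =>
    simp only [LOCC.branch, Matrix.trace_sum]
    rw [Finset.sum_comm]
    simp only [ih]
    calc _ = ∑ k, ((((K k)ᴴ * K k) ⊗ₖ (1 : Matrix (Fin b) (Fin b) ℂ)) * ρ).trace := by
          refine Finset.sum_congr rfl fun k _ => ?_
          rw [Matrix.trace_mul_comm, ← Matrix.mul_assoc, Matrix.conjTranspose_kronecker,
            ← Matrix.mul_kronecker_mul]
          simp
      _ = (((∑ k, (K k)ᴴ * K k) ⊗ₖ (1 : Matrix (Fin b) (Fin b) ℂ)) * ρ).trace := by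
          rw [← Matrix.trace_sum, ← Finset.sum_mul]
          congr 2
          ext x y
          simp [Matrix.sum_apply, Matrix.kroneckerMap_apply, Finset.sum_mul]
      _ = _ := by rw [hK]; simp
  | @bob a b r c K hK next ih =>
    simp only [LOCC.branch, Matrix.trace_sum]
    rw [Finset.sum_comm]
    simp only [ih]
    calc _ = ∑ k, (((1 : Matrix (Fin a) (Fin a) ℂ) ⊗ₖ ((K k)ᴴ * K k)) * ρ).trace := by
          refine Finset.sum_congr rfl fun k _ => ?_
          rw [Matrix.trace_mul_comm, ← Matrix.mul_assoc, Matrix.conjTranspose_kronecker,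
            ← Matrix.mul_kronecker_mul]
          simp
      _ = (((1 : Matrix (Fin a) (Fin a) ℂ) ⊗ₖ (∑ k, (K k)ᴴ * K k)) * ρ).trace := by
          rw [← Matrix.trace_sum, ← Finset.sum_mul]
          congr 2
          ext x y
          simp [Matrix.sum_apply, Matrix.kroneckerMap_apply, Finset.mul_sum]
      _ = _ := by rw [hK]; simp

end LOCC

/-! ### Compact convex hulls, and product vectors in kernels. -/

/-- By Carathéodory, `finrank + 1` points suffice, so the hull is a continuous image of a simplex
times a power of `s`. Shorter combinations are padded with weight `0` at `x₀`. -/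
theorem isCompact_convexHull_of_finiteDimensional {E : Type*} [AddCommGroup E] [Module ℝ E]
    [TopologicalSpace E] [ContinuousAdd E] [ContinuousSMul ℝ E] [FiniteDimensional ℝ E]
    {s : Set E} (hs : IsCompact s) : IsCompact (convexHull ℝ s) := by
  rcases s.eq_empty_or_nonempty with rfl | ⟨x₀, hx₀⟩
  · simp
  set N := Module.finrank ℝ E + 1
  have himg : convexHull ℝ s = (fun p : (Fin N → ℝ) × (Fin N → E) => ∑ i, p.1 i • p.2 i) ''
      (stdSimplex ℝ (Fin N) ×ˢ Set.univ.pi fun _ => s) := by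
    apply Set.Subset.antisymm
    · intro x hx
      obtain ⟨ι, _, z, w, hz, hind, hw, hsum, rfl⟩ := eq_pos_convex_span_of_mem_convexHull hx
      have hcard : Fintype.card ι ≤ Fintype.card (Fin N) := by
        rw [Fintype.card_fin]
        exact hind.card_le_finrank_succ.trans (Nat.succ_le_succ (Submodule.finrank_le _))
      obtain ⟨e⟩ := Function.Embedding.nonempty_of_card_le hcard
      have hsupp : ∀ g : Fin N → E, (∀ i, i ∉ Set.range e → g i = 0) →
          ∑ i, g i = ∑ j, g (e j) := fun g hg =>
        (Fintype.sum_of_injective e e.injective _ g hg fun _ => rfl).symm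
      have hsupp' : ∀ g : Fin N → ℝ, (∀ i, i ∉ Set.range e → g i = 0) →
          ∑ i, g i = ∑ j, g (e j) := fun g hg =>
        (Fintype.sum_of_injective e e.injective _ g hg fun _ => rfl).symm
      refine ⟨(Function.extend e w 0, Function.extend e z fun _ => x₀),
        ⟨⟨fun i => ?_, ?_⟩, fun i _ => ?_⟩, ?_⟩
      · by_cases hi : ∃ j, e j = i
        · obtain ⟨j, rfl⟩ := hi
          simpa [e.injective.extend_apply] using (hw j).le
        · simp [Function.extend_apply' _ _ _ hi]
      · rw [hsupp']
        · simpa [e.injective.extend_apply] using hsum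
        · intro i hi
          exact Function.extend_apply' _ _ _ hi
      · by_cases hi : ∃ j, e j = i
        · obtain ⟨j, rfl⟩ := hi
          simpa [e.injective.extend_apply] using hz ⟨j, rfl⟩
        · simpa [Function.extend_apply' _ _ _ hi] using hx₀
      · change ∑ i, Function.extend e w 0 i • Function.extend e z (fun _ => x₀) i = _
        rw [hsupp]
        · simp [e.injective.extend_apply]
        · intro i hi
          rw [Function.extend_apply' _ _ _ hi, Pi.zero_apply, zero_smul]
    · rintro _ ⟨⟨w, z⟩, ⟨hw, hz⟩, rfl⟩
      exact (convex_convexHull ℝ s).sum_mem (fun i _ => hw.1 i) hw.2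
        fun i _ => subset_convexHull ℝ s (hz i trivial)
  rw [himg]
  refine ((isCompact_stdSimplex ℝ (Fin N)).prod (isCompact_univ_pi fun _ => hs)).image ?_
  exact continuous_finsetSum _ fun i _ =>
    ((continuous_apply i).comp continuous_fst).smul ((continuous_apply i).comp continuous_snd)

/-- The product vector `a ⊗ b`. -/
def prodVec (a b : Fin 2 → ℂ) : Fin 2 × Fin 2 → ℂ := fun x => a x.1 * b x.2

theorem exists_prodVec_of_det_eq_zero {w : Fin 2 × Fin 2 → ℂ}
    (h : w (0, 0) * w (1, 1) = w (0, 1) * w (1, 0)) : ∃ a b, w = prodVec a b := by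
  by_cases h0 : w (0, 0) = 0
  · by_cases h1 : w (0, 1) = 0
    · refine ⟨![0, 1], ![w (1, 0), w (1, 1)], ?_⟩
      ext ⟨i, j⟩
      fin_cases i <;> fin_cases j <;> simp [prodVec, h0, h1]
    · have h2 : w (1, 0) = 0 := by simpa [h0, h1] using h.symm
      refine ⟨![w (0, 1), w (1, 1)], ![0, 1], ?_⟩
      ext ⟨i, j⟩
      fin_cases i <;> fin_cases j <;> simp [prodVec, h0, h2]
  · refine ⟨![w (0, 0), w (1, 0)], ![1, w (0, 1) / w (0, 0)], ?_⟩
    ext ⟨i, j⟩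
    fin_cases i <;> fin_cases j <;> simp [prodVec] <;> field_simp
    rw [mul_comm, h, mul_comm]

/-- The determinant of `v - c • k` is a quadratic polynomial in `c` with leading coefficient `det k
≠ 0`, so it has a complex root. -/
theorem exists_sub_smul_eq_prodVec {k : Fin 2 × Fin 2 → ℂ}
    (hk : k (0, 0) * k (1, 1) ≠ k (0, 1) * k (1, 0)) (v : Fin 2 × Fin 2 → ℂ) :
    ∃ (c : ℂ) (a b : Fin 2 → ℂ), v - c • k = prodVec a b := by
  obtain ⟨s, hs⟩ := IsAlgClosed.exists_pow_nat_eq (discrim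
    (k (0, 0) * k (1, 1) - k (0, 1) * k (1, 0))
    (-(v (0, 0) * k (1, 1) + k (0, 0) * v (1, 1) - v (0, 1) * k (1, 0) - k (0, 1) * v (1, 0)))
    (v (0, 0) * v (1, 1) - v (0, 1) * v (1, 0))) two_pos
  obtain ⟨c, hc⟩ := exists_quadratic_eq_zero (sub_ne_zero.mpr hk) ⟨s, by rw [← hs, sq]⟩
  obtain ⟨a, b, h⟩ := exists_prodVec_of_det_eq_zero (w := v - c • k) (by
    simp only [Pi.sub_apply, Pi.smul_apply, smul_eq_mul]
    linear_combination hc)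
  exact ⟨c, a, b, h⟩

/-- Two independent kernel vectors would span a plane containing a product vector. For a trivial
kernel `k` is an arbitrary nonzero vector. -/
theorem exists_ker_le_span {M : Op 2 2}
    (h : ∀ a b, M *ᵥ prodVec a b = 0 → prodVec a b = 0) :
    ∃ k : Fin 2 × Fin 2 → ℂ, k ≠ 0 ∧ ∀ v, M *ᵥ v = 0 → ∃ c : ℂ, v = c • k := by
  by_cases hM : ∃ k, k ≠ 0 ∧ M *ᵥ k = 0
  · obtain ⟨k, hk, hMk⟩ := hM
    refine ⟨k, hk, fun v hv => ?_⟩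
    have hdet : k (0, 0) * k (1, 1) ≠ k (0, 1) * k (1, 0) := fun hd => by
      obtain ⟨a, b, rfl⟩ := exists_prodVec_of_det_eq_zero hd
      exact hk (h a b hMk)
    obtain ⟨c, a, b, hc⟩ := exists_sub_smul_eq_prodVec hdet v
    refine ⟨c, sub_eq_zero.mp (hc.trans (h a b ?_))⟩
    rw [← hc, Matrix.mulVec_sub, Matrix.mulVec_smul, hMk, hv, smul_zero, sub_zero]
  · push Not at hM
    refine ⟨Pi.single (0, 0) 1, by simp, fun v hv => ⟨0, ?_⟩⟩
    rw [zero_smul]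
    by_contra hne
    exact hM v hne hv

/-! ### The separable cone, and separability from a product vector in the kernel. -/

/-- The cone of unnormalised separable states. -/
def sepCone : AddSubmonoid (Op 2 2) :=
  AddSubmonoid.closure
    {τ | ∃ α β : Matrix (Fin 2) (Fin 2) ℂ, α.PosSemidef ∧ β.PosSemidef ∧ τ = α ⊗ₖ β}

theorem kronecker_mem_sepCone {α β : Matrix (Fin 2) (Fin 2) ℂ} (hα : α.PosSemidef)
    (hβ : β.PosSemidef) : α ⊗ₖ β ∈ sepCone :=
  AddSubmonoid.subset_closure ⟨α, β, hα, hβ, rfl⟩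

theorem conj_mem_sepCone (U V : Matrix (Fin 2) (Fin 2) ℂ) {τ : Op 2 2} (hτ : τ ∈ sepCone) :
    (U ⊗ₖ V) * τ * (U ⊗ₖ V)ᴴ ∈ sepCone := by
  induction hτ using AddSubmonoid.closure_induction with
  | mem x hx =>
    obtain ⟨α, β, hα, hβ, rfl⟩ := hx
    rw [Matrix.conjTranspose_kronecker, ← Matrix.mul_kronecker_mul, ← Matrix.mul_kronecker_mul]
    exact kronecker_mem_sepCone (hα.mul_mul_conjTranspose_same U) (hβ.mul_mul_conjTranspose_same V)
  | zero => simp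
  | add x y _ _ ihx ihy =>
    rw [mul_add, add_mul]
    exact add_mem ihx ihy

theorem posSemidef_trace_eq {n : Type*} [Fintype n] {P : Matrix n n ℂ} (hP : P.PosSemidef) :
    P.trace = (P.trace.re : ℂ) ∧ 0 ≤ P.trace.re := by
  have h := hP.trace_nonneg
  rw [Complex.nonneg_iff] at h
  exact ⟨Complex.ext rfl h.2.symm, h.1⟩

theorem isState_smul {n : Type} [Fintype n] [DecidableEq n] {P : Matrix n n ℂ}
    (hP : P.PosSemidef) (h : 0 < P.trace.re) : IsState (P.trace.re⁻¹ • P) := by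
  refine ⟨hP.smul (inv_nonneg.mpr h.le), ?_⟩
  rw [Matrix.trace_smul, (posSemidef_trace_eq hP).1, Complex.ofReal_re, Complex.real_smul,
    ← Complex.ofReal_mul, inv_mul_cancel₀ h.ne', Complex.ofReal_one]

theorem eq_zero_of_trace_re {n : Type*} [Fintype n] [DecidableEq n] {P : Matrix n n ℂ}
    (hP : P.PosSemidef) (h : P.trace.re = 0) : P = 0 := by
  have h0 : P.trace = 0 := by rw [(posSemidef_trace_eq hP).1, h, Complex.ofReal_zero]
  obtain ⟨B, rfl⟩ := exists_eq_conjTranspose_mul_self hP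
  rw [Matrix.trace_conjTranspose_mul_self_eq_zero_iff.mp h0]
  simp

theorem eq_smul_separable_of_mem_sepCone {τ : Op 2 2} (hτ : τ ∈ sepCone) :
    ∃ (t : ℝ) (σ : Op 2 2), 0 ≤ t ∧ IsSeparable σ ∧ τ = t • σ := by
  have hex : ∃ α : Matrix (Fin 2) (Fin 2) ℂ, IsState α :=
    ⟨Matrix.diagonal ![1, 0], Matrix.PosSemidef.diagonal (by
      intro i; fin_cases i <;> simp), by simp [Matrix.trace]⟩
  obtain ⟨α₀, hα₀⟩ := hex
  have h₀ : IsSeparable (α₀ ⊗ₖ α₀) := subset_convexHull ℝ _ ⟨α₀, α₀, hα₀, hα₀, rfl⟩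
  induction hτ using AddSubmonoid.closure_induction with
  | mem x hx =>
    obtain ⟨α, β, hα, hβ, rfl⟩ := hx
    rcases (posSemidef_trace_eq hα).2.eq_or_lt with ha | ha
    · exact ⟨0, _, le_rfl, h₀, by rw [eq_zero_of_trace_re hα ha.symm]; simp⟩
    rcases (posSemidef_trace_eq hβ).2.eq_or_lt with hb | hb
    · exact ⟨0, _, le_rfl, h₀, by rw [eq_zero_of_trace_re hβ hb.symm]; simp⟩
    refine ⟨α.trace.re * β.trace.re, _, by positivity,
      subset_convexHull ℝ _ ⟨_, _, isState_smul hα ha, isState_smul hβ hb, rfl⟩, ?_⟩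
    rw [Matrix.smul_kronecker, Matrix.kronecker_smul, smul_smul, smul_smul]
    rw [show α.trace.re * β.trace.re * α.trace.re⁻¹ * β.trace.re⁻¹ = 1 by field_simp, one_smul]
  | zero => exact ⟨0, _, le_rfl, h₀, by simp⟩
  | add x y _ _ ihx ihy =>
    obtain ⟨s, σ, hs, hσ, rfl⟩ := ihx
    obtain ⟨t, τ, ht, hτ, rfl⟩ := ihy
    rcases (add_nonneg hs ht).eq_or_lt with h | h
    · obtain rfl : s = 0 := by linarith
      obtain rfl : t = 0 := by linarith
      exact ⟨0, _, le_rfl, h₀, by simp⟩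
    · refine ⟨s + t, (s / (s + t)) • σ + (t / (s + t)) • τ, h.le,
        convex_convexHull ℝ _ hσ hτ (by positivity) (by positivity) (by field_simp), ?_⟩
      rw [smul_add, smul_smul, smul_smul, mul_div_cancel₀ _ h.ne', mul_div_cancel₀ _ h.ne']

theorem IsSeparable.isState {τ : Op 2 2} (h : IsSeparable τ) : IsState τ ∧ (pT τ).PosSemidef := by
  have hconv : Convex ℝ {τ : Op 2 2 | IsState τ ∧ (pT τ).PosSemidef} := by
    intro x hx y hy s t hs ht hst
    refine ⟨⟨(hx.1.1.smul hs).add (hy.1.1.smul ht), ?_⟩, ?_⟩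
    · rw [Matrix.trace_add, Matrix.trace_smul, Matrix.trace_smul, hx.1.2, hy.1.2, ← add_smul, hst,
        one_smul]
    · rw [pT_add, pT_smul, pT_smul]
      exact (hx.2.smul hs).add (hy.2.smul ht)
  refine convexHull_min ?_ hconv h
  rintro _ ⟨α, β, hα, hβ, rfl⟩
  refine ⟨⟨hα.1.kronecker hβ.1, ?_⟩, ?_⟩
  · rw [Matrix.trace_kronecker, hα.2, hβ.2, one_mul]
  · exact hα.1.kronecker hβ.1.transpose

theorem isSeparable_of_mem_sepCone {τ : Op 2 2} (hτ : τ ∈ sepCone) (h1 : τ.trace = 1) :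
    IsSeparable τ := by
  obtain ⟨t, σ, -, hσ, rfl⟩ := eq_smul_separable_of_mem_sepCone hτ
  rw [Matrix.trace_smul, hσ.isState.1.2, Complex.real_smul, mul_one] at h1
  rwa [Complex.ofReal_eq_one.mp h1, one_smul]

/-- The vector `|00⟩` is also killed by `σ^Γ`, which removes the coherence between `|01⟩` and
`|10⟩`. What remains couples `|01⟩` and `|10⟩` only through `|11⟩`, and a Schur complement splits it
as `α ⊗ |1⟩⟨1| + |1⟩⟨1| ⊗ β`. -/
theorem mem_sepCone_of_mulVec_single_eq_zero {σ : Op 2 2} (h : σ.PosSemidef)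
    (hΓ : (pT σ).PosSemidef) (h0 : σ *ᵥ Pi.single (0, 0) 1 = 0) : σ ∈ sepCone := by
  have hcol : ∀ x, σ x (0, 0) = 0 := fun x => by
    simpa using congrFun h0 x
  -- `σ` and `σ^Γ` share their diagonal, and a zero diagonal entry of a positive matrix forces a
  -- zero column.
  have hΓ0 : pT σ *ᵥ Pi.single (0, 0) 1 = 0 := by
    rw [← hΓ.dotProduct_mulVec_zero_iff]
    simp [hcol]
  have hcolΓ : ∀ i j, σ (i, 0) (0, j) = 0 := fun i j => by
    simpa using congrFun hΓ0 (i, j)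
  have herm : ∀ x y, σ x y = star (σ y x) := fun x y => (h.1.apply x y).symm
  have hp : 0 ≤ σ (0, 1) (0, 1) := h.diag_nonneg
  have hpstar : star (σ (0, 1) (0, 1)) = σ (0, 1) (0, 1) := h.1.apply _ _
  have hu : σ (0, 1) (0, 1) = 0 → σ (0, 1) (1, 1) = 0 := fun hp0 => by
    have : σ *ᵥ Pi.single (0, 1) 1 = 0 := by
      rw [← h.dotProduct_mulVec_zero_iff]
      simp [hp0]
    rw [herm]
    simpa using congrFun this (1, 1)
  set p := σ (0, 1) (0, 1) with hpdef
  set u := σ (0, 1) (1, 1) with hudef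
  set α : Matrix (Fin 2) (Fin 2) ℂ := !![p, u; star u, star u * u / p] with hα
  set β : Matrix (Fin 2) (Fin 2) ℂ :=
    !![σ (1, 0) (1, 0), σ (1, 0) (1, 1); σ (1, 1) (1, 0), σ (1, 1) (1, 1) - star u * u / p]
    with hβ
  have hα' : α.PosSemidef := by
    by_cases hp0 : p = 0
    · have : α = 0 := by
        ext i j
        fin_cases i <;> fin_cases j <;> simp [hα, hp0, hu hp0]
      rw [this]
      exact Matrix.PosSemidef.zero
    · have : α = p⁻¹ • Matrix.vecMulVec ![p, star u] (star ![p, star u]) := by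
        ext i j
        have hpc : (starRingEnd ℂ) p = p := hpstar
        rw [Matrix.smul_apply, Matrix.vecMulVec_apply, Pi.star_apply]
        fin_cases i <;> fin_cases j <;> simp [hα, hpc] <;> field_simp
      rw [this]
      exact (Matrix.posSemidef_vecMulVec_self_star _).smul (inv_nonneg.mpr hp)
  have hβ' : β.PosSemidef := by
    -- `β` is the compression of `σ` to `|10⟩` and `|11⟩ - (u/p)|01⟩`. If `p = 0` then `u = 0`, and
    -- `u / p` is read as `0`.
    have : β = (Matrix.of fun (x : Fin 2 × Fin 2) (i : Fin 2) =>
        if x = (1, i) then 1 else if x = (0, 1) ∧ i = 1 then -(u / p) else 0)ᴴ * σ *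
        (Matrix.of fun (x : Fin 2 × Fin 2) (i : Fin 2) =>
        if x = (1, i) then 1 else if x = (0, 1) ∧ i = 1 then -(u / p) else 0) := by
      have h1 : σ (0, 1) (1, 0) = 0 := by rw [herm, hcolΓ, star_zero]
      have h2 : σ (1, 1) (0, 1) = star u := herm _ _
      ext i j
      fin_cases i <;> fin_cases j <;>
        simp [hβ, Matrix.mul_apply, Fintype.sum_prod_type, hcolΓ, h1, h2, ← hpdef, ← hudef]
      by_cases hp0 : p = 0
      · simp [hp0]
      · have hpc : (starRingEnd ℂ) p = p := hpstar
        rw [hpc]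
        field_simp
        ring
    rw [this]
    exact h.conjTranspose_mul_mul_same _
  have hE : (Matrix.diagonal ![(0 : ℂ), 1]).PosSemidef := Matrix.PosSemidef.diagonal (by
    intro i; fin_cases i <;> simp)
  have hσ : σ = α ⊗ₖ Matrix.diagonal ![0, 1] + Matrix.diagonal ![0, 1] ⊗ₖ β := by
    have h1 : σ (0, 1) (1, 0) = 0 := by rw [herm, hcolΓ, star_zero]
    have h2 : σ (1, 1) (0, 1) = star u := herm _ _
    have hrow : ∀ x, σ (0, 0) x = 0 := fun x => by rw [herm, hcol, star_zero]
    ext ⟨i, j⟩ ⟨k, l⟩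
    fin_cases i <;> fin_cases j <;> fin_cases k <;> fin_cases l <;>
      simp [hα, hβ, hcol, hcolΓ, hrow, h1, h2, ← hpdef, ← hudef]
  rw [hσ]
  exact add_mem (kronecker_mem_sepCone hα' hE) (kronecker_mem_sepCone hE hβ')

theorem exists_isUnit_col {a : Fin 2 → ℂ} (ha : a ≠ 0) :
    ∃ U : Matrix (Fin 2) (Fin 2) ℂ, IsUnit U.det ∧ ∀ i, U i 0 = a i := by
  by_cases h0 : a 0 = 0
  · have h1 : a 1 ≠ 0 := fun h1 => ha (by ext i; fin_cases i <;> assumption)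
    refine ⟨!![a 0, 1; a 1, 0], ?_, fun i => by fin_cases i <;> rfl⟩
    simpa [Matrix.det_fin_two] using h1
  · refine ⟨!![a 0, 0; a 1, 1], ?_, fun i => by fin_cases i <;> rfl⟩
    simpa [Matrix.det_fin_two] using h0

/-- An invertible local change of basis moves `a ⊗ b` to `|00⟩`; it preserves both positivity
conditions, and its inverse preserves the separable cone. -/
theorem mem_sepCone_of_prodVec_mem_ker {ρ : Op 2 2} (h : ρ.PosSemidef) (hΓ : (pT ρ).PosSemidef)
    {a b : Fin 2 → ℂ} (hab : prodVec a b ≠ 0) (h0 : ρ *ᵥ prodVec a b = 0) : ρ ∈ sepCone := by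
  obtain ⟨U, hU, hUa⟩ := exists_isUnit_col (a := a) (by
    rintro rfl; exact hab (by ext x; simp [prodVec]))
  obtain ⟨V, hV, hVb⟩ := exists_isUnit_col (a := b) (by
    rintro rfl; exact hab (by ext x; simp [prodVec]))
  have key : (Uᴴ ⊗ₖ Vᴴ) * ρ * (Uᴴ ⊗ₖ Vᴴ)ᴴ ∈ sepCone := by
    apply mem_sepCone_of_mulVec_single_eq_zero (h.mul_mul_conjTranspose_same _)
    · rw [pT_conj]
      exact hΓ.mul_mul_conjTranspose_same _
    · have : (Uᴴ ⊗ₖ Vᴴ)ᴴ *ᵥ Pi.single (0, 0) 1 = prodVec a b := by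
        ext x
        simp [prodVec, Matrix.conjTranspose_kronecker, hUa, hVb]
      rw [← Matrix.mulVec_mulVec, this, ← Matrix.mulVec_mulVec, h0, Matrix.mulVec_zero]
  have := conj_mem_sepCone (Uᴴ⁻¹) (Vᴴ⁻¹) key
  have hinv : (Uᴴ⁻¹ ⊗ₖ Vᴴ⁻¹) * (Uᴴ ⊗ₖ Vᴴ) = 1 := by
    rw [← Matrix.mul_kronecker_mul, Matrix.nonsing_inv_mul _ (by
      rw [Matrix.det_conjTranspose]; exact hU.star), Matrix.nonsing_inv_mul _ (by
      rw [Matrix.det_conjTranspose]; exact hV.star), Matrix.one_kronecker_one]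
  have hinv' : (Uᴴ ⊗ₖ Vᴴ)ᴴ * (Uᴴ⁻¹ ⊗ₖ Vᴴ⁻¹)ᴴ = 1 := by
    rw [← Matrix.conjTranspose_mul, hinv, Matrix.conjTranspose_one]
  have e : (Uᴴ⁻¹ ⊗ₖ Vᴴ⁻¹) * ((Uᴴ ⊗ₖ Vᴴ) * ρ * (Uᴴ ⊗ₖ Vᴴ)ᴴ) * (Uᴴ⁻¹ ⊗ₖ Vᴴ⁻¹)ᴴ =
      ((Uᴴ⁻¹ ⊗ₖ Vᴴ⁻¹) * (Uᴴ ⊗ₖ Vᴴ)) * ρ * ((Uᴴ ⊗ₖ Vᴴ)ᴴ * (Uᴴ⁻¹ ⊗ₖ Vᴴ⁻¹)ᴴ) := by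
    simp only [mul_assoc]
  rwa [e, hinv, hinv', one_mul, mul_one] at this

/-! ### Perturbing states whose kernels are at most one-dimensional. -/

theorem posSemidef_of_re_nonneg {n : Type*} [Fintype n] {M : Matrix n n ℂ} (hM : M.IsHermitian)
    (h : ∀ v, 0 ≤ (star v ⬝ᵥ M *ᵥ v).re) : M.PosSemidef :=
  .of_dotProduct_mulVec_nonneg hM fun v =>
    Complex.nonneg_iff.mpr ⟨h v, (hM.im_star_dotProduct_mulVec_self v).symm⟩

/-- Away from the kernel the form of `ρ` is bounded below on a compact set of normalised vectors, so
it dominates a small multiple of the form of `X`; on the kernel both vanish. -/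
theorem exists_posSemidef_add_smul {n : Type*} [Fintype n] [DecidableEq n] {ρ X : Matrix n n ℂ}
    (hρ : ρ.PosSemidef) (hX : X.IsHermitian) {k : n → ℂ} (hk : k ≠ 0)
    (hker : ∀ v, ρ *ᵥ v = 0 → ∃ c : ℂ, v = c • k) (hXk : X *ᵥ k = 0) :
    ∃ ε : ℝ, 0 < ε ∧ ∀ t : ℝ, |t| ≤ ε → (ρ + t • X).PosSemidef := by
  -- Orthogonality to `k` is imposed only when `k` really lies in the kernel; otherwise `S` is the
  -- whole unit sphere.
  set S : Set (n → ℂ) := {v | ‖v‖ = 1 ∧ (ρ *ᵥ k = 0 → star k ⬝ᵥ v = 0)} with hS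
  have hkk : star k ⬝ᵥ k ≠ 0 := fun h => hk (dotProduct_star_self_eq_zero.mp (by simpa using h))
  have hScomp : IsCompact S := by
    refine (isCompact_sphere (0 : n → ℂ) 1).of_isClosed_subset ?_ fun v hv => by
      simpa using hv.1
    have hcl : IsClosed {v : n → ℂ | ρ *ᵥ k = 0 → star k ⬝ᵥ v = 0} := by
      by_cases h : ρ *ᵥ k = 0
      · simp only [h, forall_true_left]
        exact isClosed_eq (by fun_prop) continuous_const
      · simp [h]
    exact (isClosed_eq continuous_norm continuous_const).inter hcl
  have hpos : ∀ v, v ≠ 0 → (ρ *ᵥ k = 0 → star k ⬝ᵥ v = 0) → 0 < (star v ⬝ᵥ ρ *ᵥ v).re := by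
    intro v hv hv'
    have h0 := Complex.nonneg_iff.mp (hρ.dotProduct_mulVec_nonneg v)
    refine h0.1.lt_of_ne fun he => hv ?_
    have hz : ρ *ᵥ v = 0 := (hρ.dotProduct_mulVec_zero_iff v).mp (Complex.ext he.symm h0.2.symm)
    obtain ⟨c, rfl⟩ := hker v hz
    by_cases hc : c = 0
    · simp [hc]
    · have hρk : ρ *ᵥ k = 0 := by
        simpa [Matrix.mulVec_smul, hc] using hz
      have := hv' hρk
      simp [hc, hkk] at this
  obtain ⟨C, hC⟩ := hScomp.exists_bound_of_continuousOn
    (f := fun v => (star v ⬝ᵥ X *ᵥ v).re / (star v ⬝ᵥ ρ *ᵥ v).re) (by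
      refine ContinuousOn.div (by fun_prop) (by fun_prop) fun v hv => (hpos v ?_ hv.2).ne'
      rintro rfl
      simp [hS] at hv)
  refine ⟨1 / (|C| + 1), by positivity, fun t ht => ?_⟩
  have hM : (ρ + t • X).IsHermitian := hρ.1.add (by
    rw [Matrix.IsHermitian, Matrix.conjTranspose_smul, hX, star_trivial])
  have hform : ∀ v, (star v ⬝ᵥ (ρ + t • X) *ᵥ v).re =
      (star v ⬝ᵥ ρ *ᵥ v).re + t * (star v ⬝ᵥ X *ᵥ v).re := fun v => by
    rw [Matrix.add_mulVec, dotProduct_add, Matrix.smul_mulVec, dotProduct_smul]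
    simp
  have hSnn : ∀ v ∈ S, 0 ≤ (star v ⬝ᵥ (ρ + t • X) *ᵥ v).re := by
    intro v hv
    have hg := hpos v (by rintro rfl; simp [hS] at hv) hv.2
    have h1 := hC v hv
    rw [Real.norm_eq_abs, abs_div, abs_of_pos hg, div_le_iff₀ hg] at h1
    have h2 : |t * (star v ⬝ᵥ X *ᵥ v).re| ≤ (star v ⬝ᵥ ρ *ᵥ v).re := by
      rw [abs_mul]
      calc _ ≤ 1 / (|C| + 1) * ((|C| + 1) * (star v ⬝ᵥ ρ *ᵥ v).re) := by
            refine mul_le_mul ht (h1.trans ?_) (abs_nonneg _) (by positivity)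
            exact mul_le_mul_of_nonneg_right ((le_abs_self C).trans (by linarith)) hg.le
        _ = _ := by field_simp
    rw [hform]
    linarith [neg_abs_le (t * (star v ⬝ᵥ X *ᵥ v).re)]
  have hSnn' : ∀ v, (ρ *ᵥ k = 0 → star k ⬝ᵥ v = 0) →
      0 ≤ (star v ⬝ᵥ (ρ + t • X) *ᵥ v).re := by
    intro v hv
    by_cases hv0 : v = 0
    · simp [hv0]
    have hn : ‖v‖ ≠ 0 := norm_ne_zero_iff.mpr hv0
    have h1 := hSnn ((‖v‖⁻¹ : ℝ) • v) ⟨by rw [norm_smul]; simp [hn], fun h => by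
      rw [dotProduct_smul, hv h, smul_zero]⟩
    rw [star_smul, Matrix.mulVec_smul, smul_dotProduct, dotProduct_smul, smul_smul,
      Complex.smul_re, smul_eq_mul] at h1
    exact nonneg_of_mul_nonneg_right h1 (by simp; positivity)
  refine posSemidef_of_re_nonneg hM fun v => ?_
  by_cases hρk : ρ *ᵥ k = 0
  · set c := (star k ⬝ᵥ v) / (star k ⬝ᵥ k) with hc
    have hMk : (ρ + t • X) *ᵥ k = 0 := by
      rw [Matrix.add_mulVec, Matrix.smul_mulVec, hρk, hXk, smul_zero, add_zero]
    have hkM : star k ᵥ* (ρ + t • X) = 0 := by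
      have := congrArg star hMk
      rwa [Matrix.star_mulVec, hM.eq, star_zero] at this
    have h1 := hSnn' (v - c • k) fun _ => by
      rw [dotProduct_sub, dotProduct_smul, smul_eq_mul, hc, div_mul_cancel₀ _ hkk, sub_self]
    rwa [Matrix.mulVec_sub, Matrix.mulVec_smul, hMk, smul_zero, sub_zero, star_sub, star_smul,
      sub_dotProduct, smul_dotProduct, Matrix.dotProduct_mulVec (star k), hkM, zero_dotProduct,
      smul_zero, sub_zero] at h1
  · exact hSnn' v fun h => absurd h hρk

/-- Since `⟨k|Y|k⟩` is real, `Y k = 0` costs one real condition less than its coordinates suggest: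
seven instead of eight on two qubits. -/
theorem mulVec_eq_zero_of_coords {n : Type*} [Fintype n] [DecidableEq n] {Y : Matrix n n ℂ}
    (hY : Y.IsHermitian) {k : n → ℂ} {i : n} (hi : k i ≠ 0)
    (h1 : ∀ j, j ≠ i → (Y *ᵥ k) j = 0) (h2 : (star (k i) * (Y *ᵥ k) i).re = 0) :
    Y *ᵥ k = 0 := by
  have h3 : star k ⬝ᵥ Y *ᵥ k = star (k i) * (Y *ᵥ k) i := by
    rw [dotProduct, Finset.sum_eq_single i]
    · rfl
    · intro j _ hj
      rw [h1 j hj, mul_zero]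
    · simp
  have h4 : star (k i) * (Y *ᵥ k) i = 0 :=
    Complex.ext h2 (by rw [← h3]; exact hY.im_star_dotProduct_mulVec_self k)
  have h5 : (Y *ᵥ k) i = 0 := by simpa [hi] using h4
  ext j
  by_cases hj : j = i
  · rw [hj, h5]; rfl
  · exact h1 j hj

/-- The Hermitian matrix whose entries have the symmetric part of `M` as real parts and the
antisymmetric part of `M` as imaginary parts. -/
def hermitianOf : Matrix (Fin 2 × Fin 2) (Fin 2 × Fin 2) ℝ →ₗ[ℝ] Op 2 2 where
  toFun M := Matrix.of fun x y => ⟨M x y + M y x, M x y - M y x⟩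
  map_add' M N := by
    ext x y
    apply Complex.ext <;> simp <;> ring
  map_smul' c M := by
    ext x y
    apply Complex.ext <;> simp <;> ring

theorem isHermitian_hermitianOf (M : Matrix (Fin 2 × Fin 2) (Fin 2 × Fin 2) ℝ) :
    (hermitianOf M).IsHermitian := by
  ext x y
  apply Complex.ext
  · simp [hermitianOf, add_comm]
  · simp [hermitianOf]

theorem hermitianOf_injective : Function.Injective hermitianOf := by
  rw [injective_iff_map_eq_zero]
  intro M hM
  ext x y
  have h := congrFun (congrFun hM x) y
  have h1 := congrArg Complex.re h
  have h2 := congrArg Complex.im h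
  simp [hermitianOf] at h1 h2 ⊢
  linarith

/-- Evaluation of `X` at `k`, with the coordinate `i` replaced by a real functional. -/
def evalCoords (k : Fin 2 × Fin 2 → ℂ) (i : Fin 2 × Fin 2) :
    Op 2 2 →ₗ[ℝ] ({j // j ≠ i} → ℂ) × ℝ where
  toFun X := (fun j => (X *ᵥ k) j, (star (k i) * (X *ᵥ k) i).re)
  map_add' X Y := by
    ext
    · simp [Matrix.add_mulVec]
    · simp [Matrix.add_mulVec, mul_add]
  map_smul' c X := by
    ext
    · simp [Matrix.smul_mulVec]
    · simp [Matrix.smul_mulVec]; ring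

/-- The real part of the trace. -/
def traceRe : Op 2 2 →ₗ[ℝ] ℝ where
  toFun X := X.trace.re
  map_add' X Y := by simp
  map_smul' c X := by simp

/-- The partial transpose as a real linear map. -/
def pTLinear : Op 2 2 →ₗ[ℝ] Op 2 2 where
  toFun := pT
  map_add' _ _ := rfl
  map_smul' _ _ := rfl

/-- Dimension count: 16 real parameters against 7 + 7 conditions for the two vectors and 1 for the
trace. -/
theorem exists_isHermitian_of_ne_zero {k₁ k₂ : Fin 2 × Fin 2 → ℂ} (h₁ : k₁ ≠ 0) (h₂ : k₂ ≠ 0) :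
    ∃ X : Op 2 2, X ≠ 0 ∧ X.IsHermitian ∧ X *ᵥ k₁ = 0 ∧ pT X *ᵥ k₂ = 0 ∧ X.trace = 0 := by
  obtain ⟨i, hi⟩ := Function.ne_iff.mp h₁
  obtain ⟨j, hj⟩ := Function.ne_iff.mp h₂
  have hcard : ∀ i : Fin 2 × Fin 2, Fintype.card {j // j ≠ i} = 3 := by decide
  have hne := LinearMap.ker_ne_bot_of_finrank_lt
    (f := ((evalCoords k₁ i).prod (((evalCoords k₂ j).comp pTLinear).prod traceRe)).comp
      hermitianOf) (by
    simp [Module.finrank_prod, Module.finrank_pi_fintype, Complex.finrank_real_complex,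
      Module.finrank_matrix, hcard])
  obtain ⟨M, hM, hM0⟩ := Submodule.exists_mem_ne_zero_of_ne_bot hne
  have hX := isHermitian_hermitianOf M
  set X := hermitianOf M with hXdef
  have hM1 : evalCoords k₁ i X = 0 := congrArg Prod.fst hM
  have hM2 : evalCoords k₂ j (pT X) = 0 := congrArg (fun z => z.2.1) hM
  have hM3 : X.trace.re = 0 := congrArg (fun z => z.2.2) hM
  refine ⟨X, fun h => hM0 (hermitianOf_injective (h.trans (map_zero _).symm)), hX, ?_, ?_, ?_⟩
  · exact mulVec_eq_zero_of_coords hX hi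
      (fun l hl => congrFun (congrArg Prod.fst hM1) ⟨l, hl⟩) (congrArg Prod.snd hM1)
  · exact mulVec_eq_zero_of_coords (isHermitian_pT hX) hj
      (fun l hl => congrFun (congrArg Prod.fst hM2) ⟨l, hl⟩) (congrArg Prod.snd hM2)
  · refine Complex.ext hM3 ?_
    rw [Matrix.trace, Complex.im_sum]
    refine Finset.sum_eq_zero fun x _ => ?_
    have := congrArg Complex.im (hX.apply x x)
    simp at this
    simp
    linarith

/-! ### Compactness of state sets and the Peres–Horodecki criterion. -/

theorem isClosed_posSemidef {n : Type*} [Fintype n] :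
    IsClosed {P : Matrix n n ℂ | P.PosSemidef} := by
  simp only [Matrix.posSemidef_iff_dotProduct_mulVec, Matrix.IsHermitian]
  refine (isClosed_eq (by fun_prop) continuous_id).inter ?_
  have : {P : Matrix n n ℂ | ∀ x : n → ℂ, 0 ≤ star x ⬝ᵥ P *ᵥ x} =
      ⋂ x : n → ℂ, {P | 0 ≤ star x ⬝ᵥ P *ᵥ x} := by
    ext; simp
  change IsClosed {P : Matrix n n ℂ | ∀ x : n → ℂ, 0 ≤ star x ⬝ᵥ P *ᵥ x}
  rw [this]
  exact isClosed_iInter fun x => isClosed_le continuous_const (by fun_prop)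

/-- The principal 2×2 minors bound an off-diagonal entry by the geometric mean of two diagonal ones.
-/
theorem norm_apply_le_trace {n : Type*} [Fintype n] [DecidableEq n] {P : Matrix n n ℂ}
    (hP : P.PosSemidef) (i j : n) : ‖P i j‖ ≤ P.trace.re := by
  have hd : ∀ i, 0 ≤ P i i := fun i => hP.diag_nonneg
  have hdr : ∀ i, 0 ≤ (P i i).re := fun i => (Complex.nonneg_iff.mp (hd i)).1
  have hdi : ∀ i, (P i i).im = 0 := fun i => (Complex.nonneg_iff.mp (hd i)).2.symm
  have htr : ∀ i, (P i i).re ≤ P.trace.re := fun i => by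
    rw [Matrix.trace, Complex.re_sum]
    exact Finset.single_le_sum (f := fun i => (P i i).re) (fun i _ => hdr i) (Finset.mem_univ i)
  have hdet := (hP.submatrix ![i, j]).det_nonneg
  rw [Matrix.det_fin_two] at hdet
  simp only [Matrix.submatrix_apply, Matrix.cons_val_zero, Matrix.cons_val_one] at hdet
  rw [← hP.1.apply j i] at hdet
  have h1 := (Complex.nonneg_iff.mp hdet).1
  have h2 : ‖P i j‖ * ‖P i j‖ = (P i j).re * (P i j).re + (P i j).im * (P i j).im := by
    rw [← sq, Complex.sq_norm, Complex.normSq_apply]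
  simp [hdi] at h1
  nlinarith [norm_nonneg (P i j), htr i, htr j, hdr i, hdr j,
    mul_le_mul (htr i) (htr j) (hdr j) ((hdr i).trans (htr i))]

theorem isCompact_isState {n : Type} [Fintype n] [DecidableEq n] :
    IsCompact {ρ : Matrix n n ℂ | IsState ρ} := by
  have hK : IsCompact {ρ : Matrix n n ℂ | ∀ i j, ρ i j ∈ Metric.closedBall (0 : ℂ) 1} :=
    isCompact_pi_infinite (X := fun _ : n => n → ℂ) fun i =>
      isCompact_pi_infinite (X := fun _ : n => ℂ) fun j => isCompact_closedBall 0 1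
  refine hK.of_isClosed_subset
    (isClosed_posSemidef.inter (isClosed_eq (by fun_prop) continuous_const)) fun ρ hρ i j => ?_
  have := norm_apply_le_trace hρ.1 i j
  rw [hρ.2] at this
  simpa using this

theorem convex_isState {n : Type} [Fintype n] : Convex ℝ {ρ : Matrix n n ℂ | IsState ρ} := by
  intro x hx y hy s t hs ht hst
  refine ⟨(hx.1.smul hs).add (hy.1.smul ht), ?_⟩
  rw [Matrix.trace_add, Matrix.trace_smul, Matrix.trace_smul, hx.2, hy.2, ← add_smul, hst,
    one_smul]

theorem isClosed_isSeparable : IsClosed {ρ : Op 2 2 | IsSeparable ρ} := by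
  refine (isCompact_convexHull_of_finiteDimensional ?_).isClosed
  have : {τ : Op 2 2 | ∃ α β : Matrix (Fin 2) (Fin 2) ℂ, IsState α ∧ IsState β ∧ τ = α ⊗ₖ β} =
      (fun p : Matrix (Fin 2) (Fin 2) ℂ × Matrix (Fin 2) (Fin 2) ℂ => p.1 ⊗ₖ p.2) ''
        ({α | IsState α} ×ˢ {β | IsState β}) := by
    ext τ
    simp only [Set.mem_image, Set.mem_prod, Prod.exists]
    exact ⟨fun ⟨α, β, hα, hβ, h⟩ => ⟨α, β, ⟨hα, hβ⟩, h.symm⟩,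
      fun ⟨α, β, ⟨hα, hβ⟩, h⟩ => ⟨α, β, hα, hβ, h.symm⟩⟩
  rw [this]
  refine (isCompact_isState.prod isCompact_isState).image ?_
  refine continuous_matrix fun x y => ?_
  exact (continuous_fst.matrix_elem x.1 y.1).mul (continuous_snd.matrix_elem x.2 y.2)

/-- On product vectors partial transposition only conjugates the second factor, so the partial
transpose of a positive operator is nonnegative there. -/
theorem dotProduct_prodVec_pT (ρ : Op 2 2) (a b : Fin 2 → ℂ) :
    star (prodVec a b) ⬝ᵥ pT ρ *ᵥ prodVec a b =
      star (prodVec a (star b)) ⬝ᵥ ρ *ᵥ prodVec a (star b) := by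
  simp [prodVec, dotProduct, Matrix.mulVec, Fintype.sum_prod_type]
  ring

theorem mem_sepCone_of_extremePoint {ρ : Op 2 2}
    (hρ : ρ ∈ Set.extremePoints ℝ {ρ : Op 2 2 | IsState ρ ∧ (pT ρ).PosSemidef}) :
    ρ ∈ sepCone := by
  obtain ⟨⟨⟨hP, htr⟩, hΓ⟩, hext⟩ := hρ
  by_cases h1 : ∃ a b, prodVec a b ≠ 0 ∧ ρ *ᵥ prodVec a b = 0
  · obtain ⟨a, b, hab, h⟩ := h1
    exact mem_sepCone_of_prodVec_mem_ker hP hΓ hab h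
  have h2 : ∀ a b, pT ρ *ᵥ prodVec a b = 0 → prodVec a b = 0 := by
    intro a b h
    by_contra hne
    refine h1 ⟨a, star b, fun h0 => hne ?_, ?_⟩
    · ext x
      have := congrFun h0 x
      simpa [prodVec] using this
    · rw [← hP.dotProduct_mulVec_zero_iff, ← dotProduct_prodVec_pT, h, dotProduct_zero]
  push Not at h1
  obtain ⟨k₁, hk₁, hker₁⟩ := exists_ker_le_span (M := ρ)
    fun a b h => by_contra fun hne => h1 a b hne h
  obtain ⟨k₂, hk₂, hker₂⟩ := exists_ker_le_span h2
  obtain ⟨X, hX0, hX, hXk₁, hXk₂, hXtr⟩ := exists_isHermitian_of_ne_zero hk₁ hk₂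
  obtain ⟨ε₁, hε₁, h₁⟩ := exists_posSemidef_add_smul hP hX hk₁ hker₁ hXk₁
  obtain ⟨ε₂, hε₂, h₂⟩ := exists_posSemidef_add_smul hΓ (isHermitian_pT hX) hk₂ hker₂ hXk₂
  set ε := min ε₁ ε₂ with hε
  have hε0 : 0 < ε := lt_min hε₁ hε₂
  have hmem : ∀ t : ℝ, |t| ≤ ε → ρ + t • X ∈ {ρ : Op 2 2 | IsState ρ ∧ (pT ρ).PosSemidef} :=
    fun t ht => ⟨⟨h₁ t (ht.trans (min_le_left _ _)), by
      rw [Matrix.trace_add, Matrix.trace_smul, htr, hXtr, smul_zero, add_zero]⟩,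
      h₂ t (ht.trans (min_le_right _ _))⟩
  -- `ρ` is the midpoint of `ρ + ε X` and `ρ - ε X`, against extremality.
  have := hext (hmem ε (abs_of_pos hε0).le) (hmem (-ε) (by rw [abs_neg, abs_of_pos hε0]))
    ⟨1 / 2, 1 / 2, by norm_num, by norm_num, by norm_num, by module⟩
  rw [add_eq_left, smul_eq_zero] at this
  exact absurd this (by simp [hε0.ne', hX0])

/-- The Peres–Horodecki criterion for two qubits. -/
theorem isSeparable_of_posSemidef_pT {ρ : Op 2 2} (hρ : IsState ρ) (hΓ : (pT ρ).PosSemidef) :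
    IsSeparable ρ := by
  set S := {ρ : Op 2 2 | IsState ρ ∧ (pT ρ).PosSemidef}
  have hcont : Continuous (pT : Op 2 2 → Op 2 2) :=
    continuous_matrix fun x y => continuous_id.matrix_elem _ _
  have hcomp : IsCompact S :=
    isCompact_isState.inter_right (isClosed_posSemidef.preimage hcont)
  have hconv : Convex ℝ S := by
    refine convex_isState.inter fun x hx y hy s t hs ht _ => ?_
    exact (Matrix.PosSemidef.smul hx hs).add (Matrix.PosSemidef.smul hy ht)
  have : LocallyConvexSpace ℝ (Op 2 2) :=
    inferInstanceAs (LocallyConvexSpace ℝ (Fin 2 × Fin 2 → Fin 2 × Fin 2 → ℂ))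
  have hKM := closure_convexHull_extremePoints hcomp hconv
  have hsub : closure (convexHull ℝ (S.extremePoints ℝ)) ⊆ {ρ : Op 2 2 | IsSeparable ρ} :=
    closure_minimal (convexHull_min (fun x hx =>
      isSeparable_of_mem_sepCone (mem_sepCone_of_extremePoint hx) hx.1.1.2)
      (convex_convexHull ℝ _)) isClosed_isSeparable
  exact hsub (hKM.symm ▸ (⟨hρ, hΓ⟩ : ρ ∈ S))

/-! ### Contractions and the polar decomposition at a maximiser. -/

/-- The vector in `ℂ² ⊗ ℂ²` with coefficient matrix `A`. -/
def toVec (A : Matrix (Fin 2) (Fin 2) ℂ) : Fin 2 × Fin 2 → ℂ := fun x => A x.1 x.2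

/-- The operator norm of `A` is at most one. -/
def IsContraction {m n : Type*} [Fintype m] [DecidableEq n] (A : Matrix m n ℂ) : Prop :=
  (1 - Aᴴ * A).PosSemidef

/-- Both conditions are Schur complements of the block matrix with diagonal blocks `1` and
off-diagonal blocks `A`, `Aᴴ`. -/
theorem IsContraction.conjTranspose {m n : Type*} [Fintype m] [Fintype n] [DecidableEq m]
    [DecidableEq n] {A : Matrix m n ℂ} (hA : IsContraction A) : IsContraction Aᴴ := by
  let : Invertible (1 : Matrix m m ℂ) := invertibleOne
  let : Invertible (1 : Matrix n n ℂ) := invertibleOne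
  have h1 := Matrix.PosDef.fromBlocks₁₁ (A := (1 : Matrix m m ℂ)) A (1 : Matrix n n ℂ)
    Matrix.PosDef.one
  have h2 := Matrix.PosDef.fromBlocks₂₂ (1 : Matrix m m ℂ) A (D := (1 : Matrix n n ℂ))
    Matrix.PosDef.one
  simp only [inv_one, Matrix.mul_one] at h1 h2
  rw [IsContraction, Matrix.conjTranspose_conjTranspose]
  exact h2.mp (h1.mpr hA)

theorem convex_isContraction {m n : Type*} [Fintype m] [DecidableEq n] [Finite n] :
    Convex ℝ {A : Matrix m n ℂ | IsContraction A} := by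
  intro A hA B hB s t hs ht hst
  have key : 1 - (s • A + t • B)ᴴ * (s • A + t • B) =
      s • (1 - Aᴴ * A) + t • (1 - Bᴴ * B) + (s * t) • ((A - B)ᴴ * (A - B)) := by
    obtain rfl : t = 1 - s := by linarith
    simp only [Matrix.conjTranspose_add, Matrix.conjTranspose_smul, Matrix.conjTranspose_sub,
      Matrix.add_mul, Matrix.mul_add, Matrix.sub_mul, Matrix.mul_sub, Matrix.smul_mul,
      Matrix.mul_smul, star_trivial]
    module
  change (1 - (s • A + t • B)ᴴ * (s • A + t • B)).PosSemidef
  rw [key]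
  exact ((Matrix.PosSemidef.smul hA hs).add (Matrix.PosSemidef.smul hB ht)).add
    ((Matrix.posSemidef_conjTranspose_mul_self _).smul (mul_nonneg hs ht))

theorem conjTranspose_mul_self_apply_re {m n : Type*} [Fintype m] (A : Matrix m n ℂ) (j : n) :
    ((Aᴴ * A) j j).re = ∑ i, ‖A i j‖ ^ 2 := by
  rw [Matrix.mul_apply, Complex.re_sum]
  refine Finset.sum_congr rfl fun i _ => ?_
  rw [Matrix.conjTranspose_apply, Complex.sq_norm, Complex.normSq_apply]
  simp

theorem IsContraction.sum_sq_le {m n : Type*} [Fintype m] [DecidableEq n]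
    {A : Matrix m n ℂ} (hA : IsContraction A) (j : n) : ∑ i, ‖A i j‖ ^ 2 ≤ 1 := by
  have h := (Complex.nonneg_iff.mp (hA.diag_nonneg (i := j))).1
  rw [Matrix.sub_apply, Matrix.one_apply_eq, Complex.sub_re, Complex.one_re,
    conjTranspose_mul_self_apply_re] at h
  linarith

theorem isCompact_isContraction {m n : Type*} [Fintype m] [DecidableEq n] [Fintype n] :
    IsCompact {A : Matrix m n ℂ | IsContraction A} := by
  have hK : IsCompact {A : Matrix m n ℂ | ∀ i j, A i j ∈ Metric.closedBall (0 : ℂ) 1} :=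
    isCompact_pi_infinite (X := fun _ : m => n → ℂ) fun i =>
      isCompact_pi_infinite (X := fun _ : n => ℂ) fun j => isCompact_closedBall 0 1
  refine hK.of_isClosed_subset
    (isClosed_posSemidef.preimage (f := fun A : Matrix m n ℂ => 1 - Aᴴ * A) (by fun_prop))
    fun A hA i j => ?_
  have h1 := IsContraction.sum_sq_le hA j
  have h2 := Finset.single_le_sum (f := fun i => ‖A i j‖ ^ 2) (fun i _ => sq_nonneg _)
    (Finset.mem_univ i)
  rw [mem_closedBall_zero_iff]
  exact abs_le_one_iff_mul_self_le_one.mpr (by simpa [sq] using h2.trans h1) |> (le_abs_self _).trans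

/-- If `A` maximises `B ↦ Re tr(Bᴴ H)` over the contractions, then `H = A V diag(p) Vᴴ` with
`V` unitary and `p ≥ 0`, where `A` is isometric on the columns of `V` with `p ≠ 0`. -/
theorem exists_of_maximises_trace {n : Type*} [Fintype n] [DecidableEq n] {A H : Matrix n n ℂ}
    (hA : IsContraction A)
    (hmax : ∀ B, IsContraction B → (Bᴴ * H).trace.re ≤ (Aᴴ * H).trace.re) :
    ∃ (V : Matrix n n ℂ) (p : n → ℝ), Vᴴ * V = 1 ∧ (∀ i, 0 ≤ p i) ∧
      H = A * V * Matrix.diagonal (fun i => (p i : ℂ)) * Vᴴ ∧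
      ∀ i, p i ≠ 0 → ((A * V)ᴴ * (A * V)) i i = 1 := by
  have hM := Matrix.posSemidef_conjTranspose_mul_self H
  set V : Matrix n n ℂ := hM.1.eigenvectorUnitary.1 with hV
  set l := hM.1.eigenvalues with hl
  have hl0 : ∀ i, 0 ≤ l i := hM.eigenvalues_nonneg
  have hVV : Vᴴ * V = 1 := Unitary.coe_star_mul_self _
  have hVV' : V * Vᴴ = 1 := Unitary.coe_mul_star_self _
  have hspec : Hᴴ * H = V * Matrix.diagonal (fun i => (l i : ℂ)) * Vᴴ := by
    have := hM.1.spectral_theorem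
    rw [Unitary.conjStarAlgAut_apply] at this
    exact this
  set G := H * V with hG
  have hGG : Gᴴ * G = Matrix.diagonal (fun i => (l i : ℂ)) := by
    rw [hG, Matrix.conjTranspose_mul]
    calc Vᴴ * Hᴴ * (H * V) = Vᴴ * (Hᴴ * H) * V := by simp only [mul_assoc]
      _ = (Vᴴ * V) * Matrix.diagonal (fun i => (l i : ℂ)) * (Vᴴ * V) := by
          rw [hspec]; simp only [mul_assoc]
      _ = _ := by rw [hVV, one_mul, mul_one]
  set p : n → ℝ := fun i => √(l i) with hp
  -- The columns of `H V` are normalised; for `p i = 0` the inverse is `0` and the column vanishes.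
  -- Thus `C Vᴴ` is the partial isometry of the polar decomposition of `H`, and it serves below as
  -- competitor to `A`.
  set C := G * Matrix.diagonal (fun i => ((p i)⁻¹ : ℂ)) with hC
  have hpl : ∀ i, l i = p i * p i := fun i => (Real.mul_self_sqrt (hl0 i)).symm
  have hGC : G = C * Matrix.diagonal (fun i => (p i : ℂ)) := by
    ext i j
    rw [hC, mul_assoc, Matrix.diagonal_mul_diagonal, Matrix.mul_diagonal]
    by_cases hpj : p j = 0
    · have h1 := conjTranspose_mul_self_apply_re G j
      rw [hGG, Matrix.diagonal_apply_eq, hpl, hpj] at h1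
      have h2 := (Finset.sum_eq_zero_iff_of_nonneg (fun i _ => sq_nonneg ‖G i j‖)).mp
        (h1.symm.trans (by simp)) i (Finset.mem_univ i)
      have h3 : G i j = 0 := by simpa using h2
      rw [h3, zero_mul]
    · rw [inv_mul_cancel₀ (by exact_mod_cast hpj), mul_one]
  have hCC : Cᴴ * C = Matrix.diagonal (fun i => if p i = 0 then (0 : ℂ) else 1) := by
    rw [hC, Matrix.conjTranspose_mul, Matrix.diagonal_conjTranspose]
    rw [show ∀ D E : Matrix n n ℂ, D * Gᴴ * (G * E) = D * (Gᴴ * G) * E from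
      fun D E => by simp only [mul_assoc], hGG, Matrix.diagonal_mul_diagonal,
      Matrix.diagonal_mul_diagonal]
    congr 1
    ext i
    by_cases hpi : p i = 0
    · simp [hpi]
    · simp only [hpl, hpi, if_false, Pi.star_apply]
      have : (p i : ℂ) ≠ 0 := by exact_mod_cast hpi
      simp
      field_simp
  have hCcon : IsContraction C := by
    rw [IsContraction, hCC, ← Matrix.diagonal_one, Matrix.diagonal_sub]
    refine Matrix.PosSemidef.diagonal fun i => ?_
    by_cases hpi : p i = 0 <;> simp [hpi]
  have hB : IsContraction (C * Vᴴ) := by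
    have : 1 - (C * Vᴴ)ᴴ * (C * Vᴴ) = V * (1 - Cᴴ * C) * Vᴴ := by
      rw [mul_sub, sub_mul, mul_one, hVV', Matrix.conjTranspose_mul,
        Matrix.conjTranspose_conjTranspose]
      simp only [mul_assoc]
    rw [IsContraction, this]
    exact hCcon.mul_mul_conjTranspose_same V
  have hAV : IsContraction (A * V) := by
    have : 1 - (A * V)ᴴ * (A * V) = Vᴴ * (1 - Aᴴ * A) * V := by
      rw [mul_sub, sub_mul, mul_one, hVV, Matrix.conjTranspose_mul]
      simp only [mul_assoc]
    rw [IsContraction, this]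
    exact hA.conjTranspose_mul_mul_same V
  have hHG : H = G * Vᴴ := by rw [hG, mul_assoc, hVV', mul_one]
  have htr : ∀ B : Matrix n n ℂ, (Bᴴ * H).trace.re =
      ∑ i, p i * ∑ j, (star ((B * V) j i) * C j i).re := by
    intro B
    have : (Bᴴ * H).trace = ((B * V)ᴴ * C * Matrix.diagonal (fun i => (p i : ℂ))).trace := by
      rw [mul_assoc, ← hGC, hHG, ← mul_assoc, Matrix.trace_mul_comm, ← mul_assoc,
        Matrix.conjTranspose_mul]
    rw [this, Matrix.trace, Complex.re_sum]
    refine Finset.sum_congr rfl fun i _ => ?_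
    rw [Matrix.diag_apply, Matrix.mul_diagonal, Matrix.mul_apply, mul_comm, Complex.re_ofReal_mul,
      Complex.re_sum]
    simp [Matrix.conjTranspose_apply]
  have hmax' := hmax _ hB
  rw [htr, htr, mul_assoc, hVV, mul_one] at hmax'
  have hCn : ∀ i, ∑ j, (star (C j i) * C j i).re = if p i = 0 then 0 else 1 := by
    intro i
    have := congrArg Complex.re (congrFun (congrFun hCC i) i)
    rw [Matrix.mul_apply, Complex.re_sum, Matrix.diagonal_apply_eq] at this
    simp only [Matrix.conjTranspose_apply] at this
    rw [this]
    split_ifs <;> rfl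
  have hdist : ∀ i, p i ≠ 0 → ∑ j, ‖(A * V) j i - C j i‖ ^ 2 =
      ∑ j, ‖(A * V) j i‖ ^ 2 + 1 - 2 * ∑ j, (star ((A * V) j i) * C j i).re := by
    intro i hi
    have h1 := hCn i
    rw [if_neg hi] at h1
    rw [← h1, Finset.mul_sum, ← Finset.sum_add_distrib, ← Finset.sum_sub_distrib]
    refine Finset.sum_congr rfl fun j _ => ?_
    simp only [Complex.sq_norm, Complex.normSq_apply]
    simp
    ring
  have hle : ∀ i, p i * ∑ j, (star ((A * V) j i) * C j i).re ≤
      p i * ∑ j, (star (C j i) * C j i).re := by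
    intro i
    by_cases hi : p i = 0
    · simp [hi]
    · rw [hCn, if_neg hi]
      refine mul_le_mul_of_nonneg_left ?_ (Real.sqrt_nonneg _)
      have h1 := hdist i hi
      have h2 := hAV.sum_sq_le i
      have h3 : 0 ≤ ∑ j, ‖(A * V) j i - C j i‖ ^ 2 := Finset.sum_nonneg fun _ _ => sq_nonneg _
      linarith
  -- Optimality of `A` forces equality in each summand, hence equal columns of `A V` and `C`
  -- wherever `p i ≠ 0`.
  have heq := (Finset.sum_eq_sum_iff_of_le fun i _ => hle i).mp
    (le_antisymm (Finset.sum_le_sum fun i _ => hle i) hmax')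
  have hcol : ∀ i, p i ≠ 0 → (∑ j, ‖(A * V) j i‖ ^ 2 = 1) ∧ ∀ j, (A * V) j i = C j i := by
    intro i hi
    have h0 := mul_left_cancel₀ hi (heq i (Finset.mem_univ i))
    rw [hCn, if_neg hi] at h0
    have h1 := hdist i hi
    have h2 := hAV.sum_sq_le i
    have h3 : 0 ≤ ∑ j, ‖(A * V) j i - C j i‖ ^ 2 := Finset.sum_nonneg fun _ _ => sq_nonneg _
    refine ⟨by linarith, fun j => ?_⟩
    have h4 := (Finset.sum_eq_zero_iff_of_nonneg
      (fun j _ => sq_nonneg ‖(A * V) j i - C j i‖)).mp (by linarith) j (Finset.mem_univ j)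
    simpa [sub_eq_zero] using h4
  refine ⟨V, p, hVV, fun i => Real.sqrt_nonneg _, ?_, fun i hi => ?_⟩
  · have : A * V * Matrix.diagonal (fun i => (p i : ℂ)) = G := by
      rw [hGC]
      ext i j
      rw [Matrix.mul_diagonal, Matrix.mul_diagonal]
      by_cases hj : p j = 0
      · simp [hj]
      · rw [(hcol j hj).2]
    rw [this, ← hHG]
  · have h1 := (hcol i hi).1
    rw [← conjTranspose_mul_self_apply_re] at h1
    refine Complex.ext h1 ?_
    have := (Matrix.posSemidef_conjTranspose_mul_self (A * V)).diag_nonneg (i := i)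
    exact (Complex.nonneg_iff.mp this).2.symm

/-! ### The optimal filter and its dual certificate. -/

theorem star_toVec_dotProduct (A B : Matrix (Fin 2) (Fin 2) ℂ) :
    star (toVec A) ⬝ᵥ toVec B = (Aᴴ * B).trace := by
  simp [toVec, dotProduct, Matrix.trace, Matrix.mul_apply, Fintype.sum_prod_type]
  ring

/-- For 2×2 matrices, `tr(P) 1 - P` is the adjugate of `P`, a congruence of `Pᵀ` and hence positive
along with `P`. -/
theorem isContraction_of_trace_le {A : Matrix (Fin 2) (Fin 2) ℂ}
    (h : (Aᴴ * A).trace.re ≤ 1) : IsContraction A := by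
  have hP := Matrix.posSemidef_conjTranspose_mul_self A
  have ht := (posSemidef_trace_eq hP).1
  have key : 1 - Aᴴ * A = (1 - (Aᴴ * A).trace.re) • (1 : Matrix (Fin 2) (Fin 2) ℂ) +
      !![0, 1; -1, 0]ᴴ * (Aᴴ * A)ᵀ * !![0, 1; -1, 0] := by
    set P := Aᴴ * A
    have hc : ∀ c : ℝ, c • (1 : Matrix (Fin 2) (Fin 2) ℂ) = (c : ℂ) • 1 := fun c => by
      ext i j; simp
    rw [hc, Complex.ofReal_sub, ← ht, Matrix.trace_fin_two]
    ext i j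
    fin_cases i <;> fin_cases j <;>
      simp [Matrix.mul_apply, Fin.sum_univ_two] <;> ring
  rw [IsContraction, key]
  exact (Matrix.PosSemidef.one.smul (sub_nonneg.mpr h)).add
    (hP.transpose.conjTranspose_mul_mul_same _)

/-- Subtracting a multiple of the kernel vector `w` leaves the form unchanged and turns any `v` into
a product vector. -/
theorem posSemidef_pT_of_ker {T : Op 2 2} (hT : T.PosSemidef) {w : Fin 2 × Fin 2 → ℂ}
    (hw : w (0, 0) * w (1, 1) ≠ w (0, 1) * w (1, 0)) (h0 : pT T *ᵥ w = 0) :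
    (pT T).PosSemidef := by
  have hH := isHermitian_pT hT.1
  refine .of_dotProduct_mulVec_nonneg hH fun v => ?_
  obtain ⟨c, a, b, hc⟩ := exists_sub_smul_eq_prodVec hw v
  have hw0 : star w ᵥ* pT T = 0 := by
    have := congrArg star h0
    rwa [Matrix.star_mulVec, hH.eq, star_zero] at this
  have h1 : star (v - c • w) ⬝ᵥ pT T *ᵥ (v - c • w) = star v ⬝ᵥ pT T *ᵥ v := by
    rw [Matrix.mulVec_sub, Matrix.mulVec_smul, h0, smul_zero, sub_zero, star_sub, star_smul,
      sub_dotProduct, smul_dotProduct, Matrix.dotProduct_mulVec (star w), hw0, zero_dotProduct,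
      smul_zero, sub_zero]
  rw [← h1, hc, dotProduct_prodVec_pT]
  exact hT.dotProduct_mulVec_nonneg _

theorem re_form_add_smul {n : Type*} [Fintype n] {R : Matrix n n ℂ} (hR : R.IsHermitian)
    (v d : n → ℂ) (t : ℝ) :
    (star (v + t • d) ⬝ᵥ R *ᵥ (v + t • d)).re = (star v ⬝ᵥ R *ᵥ v).re +
      2 * t * (star d ⬝ᵥ R *ᵥ v).re + t ^ 2 * (star d ⬝ᵥ R *ᵥ d).re := by
  have hs : (star v ⬝ᵥ R *ᵥ d).re = (star d ⬝ᵥ R *ᵥ v).re := by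
    have : star v ⬝ᵥ R *ᵥ d = star (star d ⬝ᵥ R *ᵥ v) := by
      rw [Matrix.star_dotProduct, Matrix.star_mulVec, hR.eq, ← Matrix.dotProduct_mulVec]
    rw [this]
    rfl
  simp only [star_add, star_smul, star_trivial, Matrix.mulVec_add, Matrix.mulVec_smul,
    add_dotProduct, dotProduct_add, smul_dotProduct, dotProduct_smul, Complex.add_re,
    Complex.smul_re, smul_eq_mul, hs]
  ring

/-- First-order condition along the segment from `A` to `B`, which stays in the convex set of
contractions. -/
theorem re_form_nonneg_of_isMinOn {R : Op 2 2} (hR : R.IsHermitian)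
    {A B : Matrix (Fin 2) (Fin 2) ℂ} (hA : IsContraction A) (hB : IsContraction B)
    (hmin : ∀ C, IsContraction C →
      (star (toVec A) ⬝ᵥ R *ᵥ toVec A).re ≤ (star (toVec C) ⬝ᵥ R *ᵥ toVec C).re) :
    0 ≤ (star (toVec (B - A)) ⬝ᵥ R *ᵥ toVec A).re := by
  by_contra! hneg
  set x := (star (toVec (B - A)) ⬝ᵥ R *ᵥ toVec A).re
  set y := (star (toVec (B - A)) ⬝ᵥ R *ᵥ toVec (B - A)).re with hy
  -- Small enough that the linear term `2 t x` beats the quadratic term `t ^ 2 y`.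
  set t := min 1 (-x / (|y| + 1)) with ht
  have ht0 : 0 < t := lt_min one_pos (div_pos (by linarith) (by positivity))
  have ht1 : t ≤ 1 := min_le_left _ _
  have ht2 : t * (|y| + 1) ≤ -x := by
    rw [← le_div_iff₀ (by positivity)]
    exact min_le_right _ _
  have hC : IsContraction ((1 - t) • A + t • B) :=
    convex_isContraction hA hB (by linarith) ht0.le (by ring)
  have h1 := hmin _ hC
  have h2 : toVec ((1 - t) • A + t • B) = toVec A + t • toVec (B - A) := by
    ext z
    simp [toVec]
    ring
  rw [h2, re_form_add_smul hR] at h1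
  have h3 : 0 ≤ t * (2 * x + t * y) := by linarith
  have h4 := nonneg_of_mul_nonneg_right h3 ht0
  nlinarith [le_abs_self y]

/-- Optimality conditions for the filter: the largest value of `A ↦ -⟨A|ρ^Γ|A⟩` over the
contractions `A` equals the trace of some `Z ≥ 0` with `(ρ + Z)^Γ ≥ 0`. -/
theorem exists_filter_and_dual {ρ : Op 2 2} (hρ : ρ.PosSemidef) :
    ∃ (A : Matrix (Fin 2) (Fin 2) ℂ) (Z : Op 2 2), IsContraction A ∧ Z.PosSemidef ∧
      (pT (ρ + Z)).PosSemidef ∧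
      Z.trace.re = -(star (toVec A) ⬝ᵥ pT ρ *ᵥ toVec A).re := by
  have hR := isHermitian_pT hρ.1
  have h0 : IsContraction (0 : Matrix (Fin 2) (Fin 2) ℂ) := by
    simpa [IsContraction] using Matrix.PosSemidef.one
  obtain ⟨A, hA, hmin⟩ := isCompact_isContraction.exists_isMinOn ⟨_, h0⟩
    (f := fun A : Matrix (Fin 2) (Fin 2) ℂ => (star (toVec A) ⬝ᵥ pT ρ *ᵥ toVec A).re) (by
      have : Continuous (toVec : Matrix (Fin 2) (Fin 2) ℂ → _) :=
        continuous_pi fun x => continuous_id.matrix_elem _ _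
      fun_prop)
  replace hmin : ∀ C, IsContraction C → (star (toVec A) ⬝ᵥ pT ρ *ᵥ toVec A).re ≤
      (star (toVec C) ⬝ᵥ pT ρ *ᵥ toVec C).re := fun C hC => hmin hC
  change IsContraction A at hA
  have hz : toVec 0 = 0 := rfl
  have hf0 : (star (toVec A) ⬝ᵥ pT ρ *ᵥ toVec A).re ≤ 0 := by
    simpa [hz] using hmin 0 h0
  rcases hf0.lt_or_eq with hf | hf
  swap
  -- Minimum zero: every vector rescales to a contraction, so `ρ^Γ ≥ 0` already and `Z = 0` works.
  · refine ⟨A, 0, hA, .zero, ?_, by simp [hf]⟩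
    rw [add_zero]
    refine posSemidef_of_re_nonneg hR fun v => ?_
    set W : Matrix (Fin 2) (Fin 2) ℂ := Matrix.of fun i j => v (i, j) with hW
    have hWv : toVec W = v := rfl
    set s := (Wᴴ * W).trace.re with hs
    have hs0 : 0 ≤ s := (posSemidef_trace_eq (Matrix.posSemidef_conjTranspose_mul_self W)).2
    have hs1 : 0 < 1 + s := by linarith
    have hcon : IsContraction ((1 + s)⁻¹ • W) := by
      apply isContraction_of_trace_le
      rw [Matrix.conjTranspose_smul, Matrix.smul_mul, Matrix.mul_smul, smul_smul, star_trivial,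
        Matrix.trace_smul, Complex.smul_re, smul_eq_mul, ← hs, ← mul_inv, inv_mul_le_iff₀ (by positivity)]
      nlinarith
    have h1 := hmin _ hcon
    have h2 : toVec ((1 + s)⁻¹ • W) = (1 + s)⁻¹ • v := by rw [← hWv]; rfl
    rw [hf, h2, star_smul, Matrix.mulVec_smul, smul_dotProduct, dotProduct_smul, smul_smul,
      Complex.smul_re, smul_eq_mul] at h1
    exact nonneg_of_mul_nonneg_right h1 (by simp; positivity)
  · set H : Matrix (Fin 2) (Fin 2) ℂ := Matrix.of fun i j => -(pT ρ *ᵥ toVec A) (i, j) with hH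
    have hHv : toVec H = -(pT ρ *ᵥ toVec A) := rfl
    obtain ⟨V, p, hVV, hp, hHA, hiso⟩ := exists_of_maximises_trace (H := H) hA fun B hB => by
      have h1 := re_form_nonneg_of_isMinOn hR hA hB hmin
      have h2 : toVec (B - A) = toVec B - toVec A := rfl
      rw [h2, star_sub, sub_dotProduct, Complex.sub_re] at h1
      rw [← star_toVec_dotProduct, ← star_toVec_dotProduct, hHv, dotProduct_neg, dotProduct_neg,
        Complex.neg_re, Complex.neg_re]
      linarith
    -- With `H = Σ pₙ |A vₙ⟩⟨vₙ|` and `vₙ` the columns of `V`, the product vectors `A vₙ ⊗ vₙ` are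
    -- chosen so that `Z^Γ|A⟩ = H`; the partial transpose turns the second factor into the conjugate
    -- of `vₙ`.
    set z : Fin 2 → Fin 2 × Fin 2 → ℂ := fun n => prodVec (fun i => (A * V) i n) (fun i => V i n)
      with hz
    set Z : Op 2 2 := ∑ n, p n • Matrix.vecMulVec (z n) (star (z n)) with hZ
    have hZpos : Z.PosSemidef := Matrix.posSemidef_sum _ fun n _ =>
      (Matrix.posSemidef_vecMulVec_self_star _).smul (hp n)
    have hpiso : ∀ n, (p n : ℂ) * ((A * V)ᴴ * (A * V)) n n = p n := fun n => by
      by_cases hn : p n = 0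
      · simp [hn]
      · rw [hiso n hn, mul_one]
    have hZtr : Z.trace = ∑ n, (p n : ℂ) := by
      rw [hZ, Matrix.trace_sum]
      refine Finset.sum_congr rfl fun n _ => ?_
      have hVn : (Vᴴ * V) n n = 1 := by rw [hVV, Matrix.one_apply_eq]
      have : (Matrix.vecMulVec (z n) (star (z n))).trace =
          ((A * V)ᴴ * (A * V)) n n * (Vᴴ * V) n n := by
        rw [Matrix.mul_apply, Matrix.mul_apply (M := Vᴴ)]
        simp [Matrix.trace, Matrix.vecMulVec_apply, hz, prodVec, Fintype.sum_prod_type]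
        ring
      rw [Matrix.trace_smul, this, hVn, mul_one, Complex.real_smul, hpiso]
    have hAH : (Aᴴ * H).trace = ∑ n, (p n : ℂ) := by
      rw [hHA, ← mul_assoc, Matrix.trace_mul_comm, ← mul_assoc, ← mul_assoc, ← mul_assoc,
        ← Matrix.conjTranspose_mul, mul_assoc _ A V, Matrix.trace]
      refine Finset.sum_congr rfl fun n _ => ?_
      rw [Matrix.diag_apply, Matrix.mul_diagonal, mul_comm, hpiso]
    have hZA : pT Z *ᵥ toVec A = toVec H := by
      have h1 : ∀ n, pT (Matrix.vecMulVec (z n) (star (z n))) *ᵥ toVec A =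
          fun x => ((A * V)ᴴ * (A * V)) n n * ((A * V) x.1 n * star (V x.2 n)) := fun n => by
        ext ⟨i, j⟩
        rw [Matrix.mul_apply]
        simp only [Matrix.mul_apply (M := A) (N := V), Matrix.conjTranspose_apply]
        simp [Matrix.mulVec, dotProduct, Matrix.vecMulVec_apply, hz, prodVec,
          Fintype.sum_prod_type, Matrix.mul_apply, toVec]
        ring
      rw [hZ, pT_sum, Matrix.sum_mulVec]
      simp only [pT_smul, Matrix.smul_mulVec, h1]
      ext ⟨i, j⟩
      rw [toVec, hHA, Matrix.mul_apply, Finset.sum_apply]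
      refine Finset.sum_congr rfl fun n _ => ?_
      rw [Matrix.mul_diagonal, Pi.smul_apply, Complex.real_smul, ← mul_assoc, hpiso,
        Matrix.conjTranspose_apply]
      ring
    refine ⟨A, Z, hA, hZpos, ?_, ?_⟩
    · refine posSemidef_pT_of_ker (hρ.add hZpos) (w := toVec A) (fun hdet => ?_) ?_
      -- A product vector would make `⟨A|ρ^Γ|A⟩` nonnegative.
      · obtain ⟨a, b, hab⟩ := exists_prodVec_of_det_eq_zero hdet
        rw [hab, dotProduct_prodVec_pT] at hf
        exact absurd (Complex.nonneg_iff.mp (hρ.dotProduct_mulVec_nonneg _)).1 (not_le.mpr hf)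
      · rw [pT_add, Matrix.add_mulVec, hZA, hHv, add_neg_cancel]
    · rw [hZtr, ← hAH, ← star_toVec_dotProduct, hHv, dotProduct_neg, Complex.neg_re]

/-! ### Operator bounds on `|A⟩⟨A|^Γ` and on fidelities. -/

theorem form_pT_vecMulVec (A U : Matrix (Fin 2) (Fin 2) ℂ) :
    star (toVec U) ⬝ᵥ pT (Matrix.vecMulVec (toVec A) (star (toVec A))) *ᵥ toVec U =
      ∑ j, ∑ l, (Uᴴ * A) j l * star ((Uᴴ * A) l j) := by
  simp [toVec, dotProduct, Matrix.mulVec, Matrix.vecMulVec_apply, Matrix.mul_apply,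
    Fintype.sum_prod_type]
  ring

/-- With `M = Uᴴ A`, the form is the Hilbert–Schmidt pairing of `M` with its adjoint, hence at most
`‖M‖²`, and `‖M‖ ≤ ‖U‖` as `A` is a contraction. -/
theorem abs_form_pT_vecMulVec_le {A : Matrix (Fin 2) (Fin 2) ℂ} (hA : IsContraction A)
    (U : Matrix (Fin 2) (Fin 2) ℂ) :
    |(star (toVec U) ⬝ᵥ pT (Matrix.vecMulVec (toVec A) (star (toVec A))) *ᵥ toVec U).re| ≤
      (star (toVec U) ⬝ᵥ toVec U).re := by
  have h1 := (posSemidef_trace_eq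
    (hA.conjTranspose.conjTranspose_mul_mul_same U)).2
  rw [Matrix.conjTranspose_conjTranspose, mul_sub, sub_mul, mul_one, Matrix.trace_sub,
    Complex.sub_re] at h1
  set M := Uᴴ * A with hM
  have h2 : Uᴴ * (A * Aᴴ) * U = M * Mᴴ := by
    rw [hM, Matrix.conjTranspose_mul, Matrix.conjTranspose_conjTranspose]
    simp only [mul_assoc]
  have htr : ∀ P : Matrix (Fin 2) (Fin 2) ℂ, (Pᴴ * P).trace.re =
      ∑ i, ‖P i 0‖ ^ 2 + ∑ i, ‖P i 1‖ ^ 2 := fun P => by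
    rw [Matrix.trace_fin_two, Complex.add_re, conjTranspose_mul_self_apply_re,
      conjTranspose_mul_self_apply_re]
  rw [h2, Matrix.trace_mul_comm M, htr, htr] at h1
  rw [form_pT_vecMulVec, star_toVec_dotProduct, ← hM, htr]
  simp only [Fin.sum_univ_two, Complex.sq_norm, Complex.normSq_apply] at h1 ⊢
  simp only [Complex.add_re, Complex.mul_re, Complex.star_def, Complex.conj_re,
    Complex.conj_im] at h1 ⊢
  rw [abs_le]
  constructor <;>
  nlinarith [sq_nonneg ((M 0 1).re + (M 1 0).re), sq_nonneg ((M 0 1).im + (M 1 0).im),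
    sq_nonneg ((M 0 1).re - (M 1 0).re), sq_nonneg ((M 0 1).im - (M 1 0).im),
    sq_nonneg (M 0 0).re, sq_nonneg (M 0 0).im, sq_nonneg (M 1 1).re, sq_nonneg (M 1 1).im]

theorem posSemidef_one_sub_pT_vecMulVec {A : Matrix (Fin 2) (Fin 2) ℂ} (hA : IsContraction A) :
    (1 - pT (Matrix.vecMulVec (toVec A) (star (toVec A)))).PosSemidef := by
  have hH := isHermitian_pT (Matrix.posSemidef_vecMulVec_self_star (toVec A)).1
  refine posSemidef_of_re_nonneg (Matrix.isHermitian_one.sub hH) fun v => ?_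
  have h := abs_form_pT_vecMulVec_le hA (Matrix.of fun i j => v (i, j))
  change |(star v ⬝ᵥ _ *ᵥ v).re| ≤ (star v ⬝ᵥ v).re at h
  rw [Matrix.sub_mulVec, Matrix.one_mulVec, dotProduct_sub, Complex.sub_re]
  linarith [(abs_le.mp h).2]

theorem posSemidef_one_add_pT_vecMulVec {A : Matrix (Fin 2) (Fin 2) ℂ} (hA : IsContraction A) :
    (1 + pT (Matrix.vecMulVec (toVec A) (star (toVec A)))).PosSemidef := by
  have hH := isHermitian_pT (Matrix.posSemidef_vecMulVec_self_star (toVec A)).1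
  refine posSemidef_of_re_nonneg (Matrix.isHermitian_one.add hH) fun v => ?_
  have h := abs_form_pT_vecMulVec_le hA (Matrix.of fun i j => v (i, j))
  change |(star v ⬝ᵥ _ *ᵥ v).re| ≤ (star v ⬝ᵥ v).re at h
  rw [Matrix.add_mulVec, Matrix.one_mulVec, dotProduct_add, Complex.add_re]
  linarith [(abs_le.mp h).1]

theorem trace_vecMulVec_star_mul {n : Type*} [Fintype n] (v : n → ℂ) (M : Matrix n n ℂ) :
    (Matrix.vecMulVec v (star v) * M).trace = star v ⬝ᵥ M *ᵥ v := by
  rw [Matrix.trace_mul_comm, Matrix.mul_vecMulVec, Matrix.trace_vecMulVec, dotProduct_comm]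

/-- A column of norm at most one is a contraction, and so is its adjoint. -/
theorem posSemidef_one_sub_vecMulVec {n : Type*} [Fintype n] [DecidableEq n] {v : n → ℂ}
    (hv : (star v ⬝ᵥ v).re ≤ 1) : (1 - Matrix.vecMulVec v (star v)).PosSemidef := by
  have hcon : IsContraction (Matrix.replicateCol Unit v) := by
    refine posSemidef_of_re_nonneg
      (Matrix.isHermitian_one.sub (Matrix.isHermitian_conjTranspose_mul_self _)) fun x => ?_
    have h1 : star x ⬝ᵥ (1 - (Matrix.replicateCol Unit v)ᴴ * Matrix.replicateCol Unit v) *ᵥ x =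
        (1 - star v ⬝ᵥ v) * (Complex.normSq (x ()) : ℂ) := by
      rw [Complex.normSq_eq_conj_mul_self]
      simp [dotProduct, Matrix.mulVec, Matrix.mul_apply]
      ring
    rw [h1, Complex.re_mul_ofReal]
    exact mul_nonneg (by simpa using hv) (Complex.normSq_nonneg _)
  have h := hcon.conjTranspose
  rw [IsContraction, Matrix.conjTranspose_conjTranspose] at h
  convert h using 2
  ext i j
  simp [Matrix.mul_apply, Matrix.vecMulVec_apply]

/-- Here `√2 ψ` has a unitary coefficient matrix `A`; the positive operators `1 - |A⟩⟨A|^Γ` and `(σ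
+ ζ)^Γ` have nonnegative trace pairing, and the contribution of `ζ` to the form is dropped. -/
theorem IsMaximallyEntangled.form_le {ψ : Fin 2 × Fin 2 → ℂ} (hψ : IsMaximallyEntangled ψ)
    {σ ζ : Op 2 2} (hζ : ζ.PosSemidef) (hΓ : (pT (σ + ζ)).PosSemidef) :
    (star ψ ⬝ᵥ σ *ᵥ ψ).re ≤ (σ.trace.re + ζ.trace.re) / 2 := by
  set A : Matrix (Fin 2) (Fin 2) ℂ := (√2 : ℝ) • Matrix.of fun i j => ψ (i, j) with hA
  have hs : (√2 : ℝ) * √2 = 2 := Real.mul_self_sqrt (by norm_num)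
  have hAv : toVec A = (√2 : ℝ) • ψ := rfl
  have hAA : A * Aᴴ = 1 := by
    rw [hA, Matrix.conjTranspose_smul, star_trivial, Matrix.smul_mul, Matrix.mul_smul, smul_smul,
      hs]
    have : (Matrix.of fun i j => ψ (i, j)) * (Matrix.of fun i j => ψ (i, j))ᴴ =
        partialTraceB (Matrix.vecMulVec ψ (star ψ)) := by
      ext i k
      simp [partialTraceB, Matrix.mul_apply, Matrix.vecMulVec_apply]
    rw [this, hψ]
    ext i j
    simp
  have hcon : IsContraction A := by
    rw [IsContraction, mul_eq_one_comm.mp hAA, sub_self]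
    exact .zero
  have h1 := (Complex.nonneg_iff.mp
    (trace_mul_nonneg (posSemidef_one_sub_pT_vecMulVec hcon) hΓ)).1
  rw [sub_mul, one_mul, Matrix.trace_sub, trace_pT_mul_pT, trace_pT, trace_vecMulVec_star_mul,
    hAv, star_smul, Matrix.mulVec_smul, smul_dotProduct, dotProduct_smul, smul_smul, star_trivial,
    hs, Matrix.add_mulVec, dotProduct_add, Matrix.trace_add] at h1
  have h2 := (Complex.nonneg_iff.mp (hζ.dotProduct_mulVec_nonneg ψ)).1
  simp at h1
  linarith

/-! ### The one-way filtering protocol. -/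

/-- The maximally entangled vector `(|00⟩ + |11⟩)/√2`. -/
def bell : Fin 2 × Fin 2 → ℂ := (√2⁻¹ : ℝ) • toVec 1

theorem isMaximallyEntangled_bell : IsMaximallyEntangled bell := by
  have hs : ((√2 : ℝ) : ℂ) * (√2 : ℝ) = 2 := by
    rw [← Complex.ofReal_mul, Real.mul_self_sqrt (by norm_num)]
    norm_num
  ext i k
  fin_cases i <;> fin_cases k <;>
    simp [partialTraceB, Matrix.vecMulVec_apply, bell, toVec, ← mul_inv, hs]

/-- Both parties discard their systems and prepare `|0⟩`. -/
def reset : LOCC Unit 2 2 :=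
  .alice (r := 2) (fun _ => 2) (fun k => Matrix.single 0 k 1)
    (by ext i j; fin_cases i <;> fin_cases j <;> simp [Fin.sum_univ_two])
    fun _ => .bob (r := 2) (fun _ => 2) (fun k => Matrix.single 0 k 1)
      (by ext i j; fin_cases i <;> fin_cases j <;> simp [Fin.sum_univ_two])
      fun _ => .done ()

theorem branch_reset (σ : Op 2 2) :
    reset.branch () σ = Matrix.single (0, 0) (0, 0) σ.trace := by
  have h : ∀ k l : Fin 2, ((1 : Matrix (Fin 2) (Fin 2) ℂ) ⊗ₖ (Matrix.single 0 l 1 : Matrix (Fin 2) (Fin 2) ℂ)) *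
      (((Matrix.single 0 k 1 : Matrix (Fin 2) (Fin 2) ℂ) ⊗ₖ (1 : Matrix (Fin 2) (Fin 2) ℂ)) * σ *
        ((Matrix.single 0 k 1 : Matrix (Fin 2) (Fin 2) ℂ) ⊗ₖ (1 : Matrix (Fin 2) (Fin 2) ℂ))ᴴ) *
      ((1 : Matrix (Fin 2) (Fin 2) ℂ) ⊗ₖ (Matrix.single 0 l 1 : Matrix (Fin 2) (Fin 2) ℂ))ᴴ =
      Matrix.single (0, 0) (0, 0) (σ (k, l) (k, l)) := by
    intro k l
    have h1 : ((1 : Matrix (Fin 2) (Fin 2) ℂ) ⊗ₖ (Matrix.single 0 l 1 : Matrix (Fin 2) (Fin 2) ℂ)) *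
        ((Matrix.single 0 k 1 : Matrix (Fin 2) (Fin 2) ℂ) ⊗ₖ (1 : Matrix (Fin 2) (Fin 2) ℂ)) =
        (Matrix.single (0, 0) (k, l) 1 : Op 2 2) := by
      rw [← Matrix.mul_kronecker_mul, one_mul, mul_one]
      ext ⟨a, b⟩ ⟨c, d⟩
      simp [Matrix.single_apply]
      grind
    rw [show ∀ P Q R S : Op 2 2, P * (Q * σ * R) * S = (P * Q) * σ * (R * S) from
      fun P Q R S => by simp only [mul_assoc], h1, ← Matrix.conjTranspose_mul, h1]
    simp
  simp only [reset, LOCC.branch, if_true]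
  refine (Finset.sum_congr rfl fun k _ => Finset.sum_congr rfl fun l _ => h k l).trans ?_
  simp [Matrix.trace, Fintype.sum_prod_type, ← Matrix.single_add]

/-- The one-way protocol with the filter `K`: if it fails, both parties prepare `|0⟩`. -/
def filterProtocol (K L : Matrix (Fin 2) (Fin 2) ℂ) (h : Kᴴ * K + Lᴴ * L = 1) : LOCC Unit 2 2 :=
  .alice (r := 2) (fun _ => 2) ![K, L] (by simpa [Fin.sum_univ_two] using h)
    fun k => if k = 0 then .done () else reset

theorem channel_filterProtocol (K L : Matrix (Fin 2) (Fin 2) ℂ) (h : Kᴴ * K + Lᴴ * L = 1)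
    (ρ : Op 2 2) : (filterProtocol K L h).channel ρ =
      (K ⊗ₖ (1 : Matrix (Fin 2) (Fin 2) ℂ)) * ρ * (K ⊗ₖ (1 : Matrix (Fin 2) (Fin 2) ℂ))ᴴ +
      Matrix.single (0, 0) (0, 0) (((Lᴴ * L) ⊗ₖ (1 : Matrix (Fin 2) (Fin 2) ℂ)) * ρ).trace := by
  rw [LOCC.channel, filterProtocol, LOCC.branch, Fin.sum_univ_two]
  simp only [if_true, one_ne_zero, if_false, branch_reset, LOCC.branch]
  congr 2
  rw [Matrix.trace_mul_comm, ← mul_assoc, Matrix.conjTranspose_kronecker,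
    ← Matrix.mul_kronecker_mul]
  simp

/-- For `A = 1` this is the identity swap + 2 · singlet projector = 1, since `|1⟩⟨1|^Γ` is the swap;
the general case is its conjugation by `A ⊗ 1`. -/
theorem form_filter (A : Matrix (Fin 2) (Fin 2) ℂ) (ρ : Op 2 2) :
    star (toVec (A * !![0, 1; -1, 0]ᴴ)) ⬝ᵥ ρ *ᵥ toVec (A * !![0, 1; -1, 0]ᴴ) +
      star (toVec A) ⬝ᵥ pT ρ *ᵥ toVec A =
      (((A * Aᴴ) ⊗ₖ (1 : Matrix (Fin 2) (Fin 2) ℂ)) * ρ).trace := by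
  simp [toVec, dotProduct, Matrix.mulVec, Matrix.trace, Matrix.mul_apply, Fintype.sum_prod_type,
    Matrix.one_apply]
  ring

/-- Success contributes `⟨A Jᴴ|ρ|A Jᴴ⟩/2` and failure contributes half its probability;
`form_filter` combines the two. -/
theorem exists_protocol {A : Matrix (Fin 2) (Fin 2) ℂ} (hA : IsContraction A) {ρ : Op 2 2}
    (hρ : ρ.trace = 1) : ∃ P : LOCC Unit 2 2,
      (star bell ⬝ᵥ P.channel ρ *ᵥ bell).re =
        1 / 2 - (star (toVec A) ⬝ᵥ pT ρ *ᵥ toVec A).re / 2 := by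
  set J : Matrix (Fin 2) (Fin 2) ℂ := !![0, 1; -1, 0] with hJ
  have hJJ : Jᴴ * J = 1 := by
    ext i j; fin_cases i <;> fin_cases j <;> simp [hJ, Matrix.mul_apply]
  have hA' := hA.conjTranspose
  obtain ⟨L, hL⟩ := exists_eq_conjTranspose_mul_self hA'
  rw [Matrix.conjTranspose_conjTranspose] at hL
  have hK : (J * Aᴴ)ᴴ * (J * Aᴴ) = A * Aᴴ := by
    rw [Matrix.conjTranspose_mul, Matrix.conjTranspose_conjTranspose]
    calc A * Jᴴ * (J * Aᴴ) = A * (Jᴴ * J) * Aᴴ := by simp only [mul_assoc]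
      _ = _ := by rw [hJJ, mul_one]
  have hKL : (J * Aᴴ)ᴴ * (J * Aᴴ) + Lᴴ * L = 1 := by
    rw [hK, ← hL, add_sub_cancel]
  refine ⟨filterProtocol (J * Aᴴ) L hKL, ?_⟩
  rw [channel_filterProtocol, ← hL]
  have hs : (√2⁻¹ : ℝ) * √2⁻¹ = 1 / 2 := by
    rw [Real.mul_self_sqrt (by norm_num)]; norm_num
  have hbell : ∀ M : Op 2 2, (star bell ⬝ᵥ M *ᵥ bell).re =
      (star (toVec 1) ⬝ᵥ M *ᵥ toVec 1).re / 2 := fun M => by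
    rw [bell, star_smul, Matrix.mulVec_smul, smul_dotProduct, dotProduct_smul, smul_smul,
      star_trivial, hs, Complex.smul_re, smul_eq_mul]
    ring
  have h1 : ((J * Aᴴ) ⊗ₖ (1 : Matrix (Fin 2) (Fin 2) ℂ))ᴴ *ᵥ toVec 1 = toVec (A * Jᴴ) := by
    rw [Matrix.conjTranspose_kronecker, Matrix.conjTranspose_mul,
      Matrix.conjTranspose_conjTranspose]
    ext ⟨i, j⟩
    simp [Matrix.mulVec, dotProduct, toVec, Fintype.sum_prod_type, Matrix.one_apply]
  have h2 : star (toVec 1) ⬝ᵥ (((J * Aᴴ) ⊗ₖ (1 : Matrix (Fin 2) (Fin 2) ℂ)) * ρ *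
      ((J * Aᴴ) ⊗ₖ (1 : Matrix (Fin 2) (Fin 2) ℂ))ᴴ) *ᵥ toVec 1 =
      star (toVec (A * Jᴴ)) ⬝ᵥ ρ *ᵥ toVec (A * Jᴴ) := by
    rw [← h1, Matrix.star_mulVec, Matrix.conjTranspose_conjTranspose, ← Matrix.dotProduct_mulVec,
      Matrix.mulVec_mulVec, Matrix.mulVec_mulVec, mul_assoc]
  -- The state `|00⟩` has fidelity `1/2` with `bell`; the factor `1/2` is carried by `hbell`.
  have h3 : ∀ c : ℂ, star (toVec 1) ⬝ᵥ (Matrix.single (0, 0) (0, 0) c : Op 2 2) *ᵥ toVec 1 = c :=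
    fun c => by
      simp [Matrix.mulVec, dotProduct, toVec, Fintype.sum_prod_type, Matrix.single_apply]
  have h4 : (((1 - A * Aᴴ) ⊗ₖ (1 : Matrix (Fin 2) (Fin 2) ℂ)) * ρ).trace =
      1 - (((A * Aᴴ) ⊗ₖ (1 : Matrix (Fin 2) (Fin 2) ℂ)) * ρ).trace := by
    have : (1 - A * Aᴴ) ⊗ₖ (1 : Matrix (Fin 2) (Fin 2) ℂ) =
        1 - (A * Aᴴ) ⊗ₖ (1 : Matrix (Fin 2) (Fin 2) ℂ) := by
      rw [← Matrix.one_kronecker_one]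
      ext x y
      simp only [Matrix.kroneckerMap_apply, Matrix.sub_apply, sub_mul]
    rw [this, sub_mul, Matrix.trace_sub, one_mul, hρ]
  rw [hbell, Matrix.add_mulVec, dotProduct_add, h2, h3, h4, ← form_filter, ← hJ]
  simp only [Complex.add_re, Complex.sub_re, Complex.one_re]
  ring

/-! ### Weak and strong duality. -/

theorem LOCC.isState_channel (P : LOCC Unit 2 2) {ρ : Op 2 2} (hρ : IsState ρ) :
    IsState (P.channel ρ) := by
  refine ⟨P.posSemidef_branch () hρ.1, ?_⟩
  have := P.sum_trace_branch ρ
  rw [hρ.2] at this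
  simpa [LOCC.channel] using this

/-- The protocol is applied to `Z` as well as to `ρ`: the image of `Z` is a certificate for the
output, with the same trace. -/
theorem form_channel_le {ρ Z : Op 2 2} (hρ : IsState ρ) (hZ : Z.PosSemidef)
    (hΓ : (pT (ρ + Z)).PosSemidef) (P : LOCC Unit 2 2) {ψ : Fin 2 × Fin 2 → ℂ}
    (hψ : IsMaximallyEntangled ψ) :
    (star ψ ⬝ᵥ P.channel ρ *ᵥ ψ).re ≤ 1 / 2 + Z.trace.re / 2 := by
  have h := hψ.form_le (σ := P.channel ρ) (P.posSemidef_branch () hZ) (by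
    rw [LOCC.channel, ← LOCC.branch_add]
    exact P.posSemidef_pT_branch () hΓ)
  have hZt : (P.branch () Z).trace = Z.trace := by simpa using P.sum_trace_branch Z
  rw [(P.isState_channel hρ).2, hZt, Complex.one_re] at h
  linarith

theorem fidelity_channel_le {ρ Z : Op 2 2} (hρ : IsState ρ) (hZ : Z.PosSemidef)
    (hΓ : (pT (ρ + Z)).PosSemidef) (P : LOCC Unit 2 2) :
    fidelity (P.channel ρ) ≤ 1 / 2 + Z.trace.re / 2 := by
  refine csSup_le ⟨_, bell, isMaximallyEntangled_bell, rfl⟩ ?_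
  rintro _ ⟨ψ, hψ, rfl⟩
  exact form_channel_le hρ hZ hΓ P hψ

theorem primalValues_le {ρ Z : Op 2 2} (hZ : Z.PosSemidef)
    (hΓ : (pT (ρ + Z)).PosSemidef) {x : ℝ} (hx : x ∈ primalValues ρ) :
    x ≤ 1 / 2 + Z.trace.re / 2 := by
  obtain ⟨X, hX, -, -, hX', rfl⟩ := hx
  rw [partialTranspose_eq_pT] at hX' ⊢
  have h2 := (Complex.nonneg_iff.mp (trace_mul_nonneg hX hΓ)).1
  have h3 := (Complex.nonneg_iff.mp (trace_mul_nonneg hX' hZ)).1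
  have h4 : (X * pT Z).trace = (pT X * Z).trace := by
    rw [← trace_pT_mul_pT, pT_pT]
  rw [pT_add, mul_add, Matrix.trace_add, Complex.add_re, h4] at h2
  rw [sub_mul, Matrix.trace_sub, Complex.sub_re, smul_mul_assoc, one_mul, Matrix.trace_smul,
    smul_eq_mul] at h3
  have h5 : ((1 / 2 : ℂ) * Z.trace).re = Z.trace.re / 2 := by
    rw [(posSemidef_trace_eq hZ).1]
    simp
    ring
  rw [h5] at h3
  linarith

/-- The witness is `X = |A⟩⟨A|/2`; `X ≤ 1` because the two columns of `A` have norm at most one. -/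
theorem primalValue_mem {A : Matrix (Fin 2) (Fin 2) ℂ} (hA : IsContraction A) (ρ : Op 2 2) :
    1 / 2 - (star (toVec A) ⬝ᵥ pT ρ *ᵥ toVec A).re / 2 ∈ primalValues ρ := by
  have hhalf : (0 : ℂ) ≤ 1 / 2 := by
    rw [Complex.nonneg_iff]
    norm_num
  have hs : (√2⁻¹ : ℝ) * √2⁻¹ = 1 / 2 := by
    rw [Real.mul_self_sqrt (by norm_num)]; norm_num
  set W := Matrix.vecMulVec (toVec A) (star (toVec A)) with hW
  have hv : Matrix.vecMulVec ((√2⁻¹ : ℝ) • toVec A) (star ((√2⁻¹ : ℝ) • toVec A)) =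
      (1 / 2 : ℂ) • W := by
    rw [star_smul, star_trivial, Matrix.smul_vecMulVec, Matrix.vecMulVec_smul, smul_smul, hs]
    ext x y
    simp [hW]
  have hp : ∀ c : ℂ, pT (c • W) = c • pT W := fun c => rfl
  refine ⟨(1 / 2 : ℂ) • W, (Matrix.posSemidef_vecMulVec_self_star _).smul hhalf, ?_, ?_, ?_, ?_⟩
  · rw [← hv]
    apply posSemidef_one_sub_vecMulVec
    rw [star_smul, star_trivial, smul_dotProduct, dotProduct_smul, smul_smul, hs,
      star_toVec_dotProduct, Complex.smul_re, Matrix.trace_fin_two, Complex.add_re,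
      conjTranspose_mul_self_apply_re, conjTranspose_mul_self_apply_re, smul_eq_mul]
    linarith [hA.sum_sq_le 0, hA.sum_sq_le 1]
  · rw [partialTranspose_eq_pT, hp, ← smul_add, add_comm]
    exact (posSemidef_one_add_pT_vecMulVec hA).smul hhalf
  · rw [partialTranspose_eq_pT, hp, ← smul_sub]
    exact (posSemidef_one_sub_pT_vecMulVec hA).smul hhalf
  · rw [partialTranspose_eq_pT, smul_mul_assoc, Matrix.trace_smul, hW, trace_vecMulVec_star_mul]
    simp
    ring

/-- Strong duality, and achievability by a protocol. -/
theorem exists_dual_optimal {ρ : Op 2 2} (hρ : IsState ρ) :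
    ∃ Z : Op 2 2, Z.PosSemidef ∧ (pT (ρ + Z)).PosSemidef ∧ Fstar ρ = 1 / 2 + Z.trace.re / 2 ∧
      IsGreatest (achievableFidelities ρ) (Fstar ρ) ∧ IsGreatest (primalValues ρ) (Fstar ρ) := by
  obtain ⟨A, Z, hA, hZ, hΓ, htr⟩ := exists_filter_and_dual hρ.1
  obtain ⟨P, hP⟩ := exists_protocol hA hρ.2
  have hval : 1 / 2 - (star (toVec A) ⬝ᵥ pT ρ *ᵥ toVec A).re / 2 = 1 / 2 + Z.trace.re / 2 := by
    rw [htr]; ring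
  rw [hval] at hP
  have hfid : fidelity (P.channel ρ) = 1 / 2 + Z.trace.re / 2 := by
    refine le_antisymm (fidelity_channel_le hρ hZ hΓ P) ?_
    rw [← hP]
    refine le_csSup ⟨1 / 2 + Z.trace.re / 2, ?_⟩ ⟨bell, isMaximallyEntangled_bell, rfl⟩
    rintro _ ⟨ψ, hψ, rfl⟩
    exact form_channel_le hρ hZ hΓ P hψ
  have hgr : IsGreatest (achievableFidelities ρ) (1 / 2 + Z.trace.re / 2) :=
    ⟨⟨P, hfid.symm⟩, by rintro _ ⟨Q, rfl⟩; exact fidelity_channel_le hρ hZ hΓ Q⟩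
  have hF : Fstar ρ = 1 / 2 + Z.trace.re / 2 := hgr.csSup_eq
  refine ⟨Z, hZ, hΓ, hF, hF ▸ hgr, ?_, ?_⟩
  · rw [hF, ← hval]
    exact primalValue_mem hA ρ
  · rw [hF]
    exact fun x hx => primalValues_le hZ hΓ hx

/-! ### Minimal mixing and entanglement monotonicity. -/

theorem Fstar_le {ρ Z : Op 2 2} (hρ : IsState ρ) (hZ : Z.PosSemidef)
    (hΓ : (pT (ρ + Z)).PosSemidef) : Fstar ρ ≤ 1 / 2 + Z.trace.re / 2 := by
  obtain ⟨-, -, -, -, ⟨⟨P, hP⟩, -⟩, -⟩ := exists_dual_optimal hρ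
  rw [hP]
  exact fidelity_channel_le hρ hZ hΓ P

theorem Fstar_le_of_isSeparable {ρ ρZ : Op 2 2} (hρ : IsState ρ) (hρZ : IsState ρZ) {p : ℝ}
    (hp0 : 0 ≤ p) (hp1 : p < 1) (hsep : IsSeparable ((1 - p) • ρ + p • ρZ)) :
    Fstar ρ ≤ 1 / (2 * (1 - p)) := by
  have h1p : 0 < 1 - p := by linarith
  -- With this `Z`, `ρ + Z` is the separable mixture divided by `1 - p`.
  have h1 := Fstar_le hρ (Z := (p / (1 - p)) • ρZ) (hρZ.1.smul (div_nonneg hp0 h1p.le)) (by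
    have : ρ + (p / (1 - p)) • ρZ = (1 - p)⁻¹ • ((1 - p) • ρ + p • ρZ) := by
      rw [smul_add, smul_smul, smul_smul, inv_mul_cancel₀ h1p.ne', one_smul, div_eq_inv_mul]
    rw [this, pT_smul]
    exact hsep.isState.2.smul (inv_nonneg.mpr h1p.le))
  refine h1.trans_eq ?_
  rw [Matrix.trace_smul, hρZ.2, Complex.smul_re, Complex.one_re, smul_eq_mul]
  field_simp
  ring

theorem exists_disentangling {ρ : Op 2 2} (hρ : IsState ρ) :
    ∃ (p : ℝ) (ρZ : Op 2 2), 0 ≤ p ∧ p < 1 ∧ IsState ρZ ∧ IsSeparable ((1 - p) • ρ + p • ρZ) ∧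
      Fstar ρ = 1 / (2 * (1 - p)) := by
  obtain ⟨Z, hZ, hΓ, hF, -⟩ := exists_dual_optimal hρ
  obtain ⟨htr, hnn⟩ := posSemidef_trace_eq hZ
  rcases hnn.eq_or_lt with h0 | h0
  · have hZ0 := eq_zero_of_trace_re hZ h0.symm
    rw [hZ0, add_zero] at hΓ
    refine ⟨0, ρ, le_rfl, one_pos, hρ, ?_, ?_⟩
    · simpa using isSeparable_of_posSemidef_pT hρ hΓ
    · rw [hF, ← h0]; norm_num
  · set d := Z.trace.re with hd
    have hd1 : 0 < 1 + d := by linarith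
    have h1p : 1 - d / (1 + d) = (1 + d)⁻¹ := by field_simp; ring
    have hst := isState_smul hZ h0
    -- The weight `d / (1 + d)` is the share of `Z` in the normalised `ρ + Z`.
    have hcomb : (1 - d / (1 + d)) • ρ + (d / (1 + d)) • (d⁻¹ • Z) = (1 + d)⁻¹ • (ρ + Z) := by
      rw [h1p, smul_add, smul_smul, show d / (1 + d) * d⁻¹ = (1 + d)⁻¹ by field_simp]
    have hp0 : 0 ≤ d / (1 + d) := by positivity
    have hp1 : d / (1 + d) < 1 := by rw [div_lt_one hd1]; linarith
    refine ⟨d / (1 + d), d⁻¹ • Z, hp0, hp1, hst, ?_, ?_⟩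
    · refine isSeparable_of_posSemidef_pT
        (convex_isState hρ hst (by linarith) hp0 (by ring)) ?_
      rw [hcomb, pT_smul]
      exact hΓ.smul (inv_nonneg.mpr hd1.le)
    · rw [hF, h1p]
      field_simp

/-- Each property transports an optimal `Z`: through the protocol, through each branch with
rescaling, or by convex combination. Faithfulness is the case `Z = 0` combined with Peres–Horodecki.
-/
theorem isEntanglementMeasure_Fstar : IsEntanglementMeasure (1 / 2) Fstar where
  le ρ hρ := by
    obtain ⟨Z, hZ, -, hF, -⟩ := exists_dual_optimal hρ
    linarith [(posSemidef_trace_eq hZ).2]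
  eq_iff ρ hρ := by
    obtain ⟨Z, hZ, hΓ, hF, -⟩ := exists_dual_optimal hρ
    have hnn := (posSemidef_trace_eq hZ).2
    constructor
    · intro h
      have hZ0 := eq_zero_of_trace_re hZ (by linarith)
      rw [hZ0, add_zero] at hΓ
      exact isSeparable_of_posSemidef_pT hρ hΓ
    · intro h
      have := Fstar_le hρ (Z := 0) .zero (by rw [add_zero]; exact h.isState.2)
      simp at this
      linarith
  monotone ρ hρ P := by
    obtain ⟨Z, hZ, hΓ, hF, -⟩ := exists_dual_optimal hρ
    have h := Fstar_le (P.isState_channel hρ) (P.posSemidef_branch () hZ) (by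
      rw [LOCC.channel, ← LOCC.branch_add]
      exact P.posSemidef_pT_branch () hΓ)
    have hZt : (P.branch () Z).trace = Z.trace := by simpa using P.sum_trace_branch Z
    rwa [hZt, ← hF] at h
  monotone_average ρ hρ m P := by
    obtain ⟨Z, hZ, hΓ, hF, -⟩ := exists_dual_optimal hρ
    have hi : ∀ i, (P.branch i ρ).trace.re *
        Fstar ((P.branch i ρ).trace.re⁻¹ • P.branch i ρ) ≤
        (P.branch i ρ).trace.re / 2 + (P.branch i Z).trace.re / 2 := by
      intro i
      have hP := P.posSemidef_branch i hρ.1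
      have hQ := P.posSemidef_branch i hZ
      rcases (posSemidef_trace_eq hP).2.eq_or_lt with h0 | h0
      · rw [← h0]
        linarith [(posSemidef_trace_eq hQ).2]
      · have h := Fstar_le (isState_smul hP h0) (Z := (P.branch i ρ).trace.re⁻¹ • P.branch i Z)
          (hQ.smul (inv_nonneg.mpr h0.le)) (by
            rw [← smul_add, ← LOCC.branch_add, pT_smul]
            exact (P.posSemidef_pT_branch i hΓ).smul (inv_nonneg.mpr h0.le))
        refine (mul_le_mul_of_nonneg_left h h0.le).trans_eq ?_
        rw [Matrix.trace_smul, Complex.smul_re, smul_eq_mul]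
        field_simp
    refine (Finset.sum_le_sum fun i _ => hi i).trans_eq ?_
    rw [Finset.sum_add_distrib, ← Finset.sum_div, ← Finset.sum_div, ← Complex.re_sum,
      ← Complex.re_sum, P.sum_trace_branch, P.sum_trace_branch, hρ.2, hF, Complex.one_re]
  convex := by
    refine ⟨convex_isState, fun ρ hρ σ hσ s t hs ht hst => ?_⟩
    obtain ⟨Y, hY, hYΓ, hYF, -⟩ := exists_dual_optimal hρ
    obtain ⟨Z, hZ, hZΓ, hZF, -⟩ := exists_dual_optimal hσ
    have h := Fstar_le (convex_isState hρ hσ hs ht hst) (Z := s • Y + t • Z)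
      ((hY.smul hs).add (hZ.smul ht)) (by
        rw [add_add_add_comm, ← smul_add, ← smul_add, pT_add, pT_smul, pT_smul]
        exact (hYΓ.smul hs).add (hZΓ.smul ht))
    refine h.trans_eq ?_
    rw [Matrix.trace_add, Matrix.trace_smul, Matrix.trace_smul, Complex.add_re, Complex.smul_re,
      Complex.smul_re, hYF, hZF]
    simp only [smul_eq_mul]
    linear_combination (-1 / 2) * hst

end TwoQubit

end

theorem mainTheorem3 :
    (∀ ρ : TwoQubit.Op 2 2, TwoQubit.IsState ρ →
      IsGreatest (TwoQubit.achievableFidelities ρ) (TwoQubit.Fstar ρ) ∧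
      IsGreatest (TwoQubit.primalValues ρ) (TwoQubit.Fstar ρ) ∧
      IsLeast (TwoQubit.dualValues ρ) (TwoQubit.Fstar ρ) ∧
      IsLeast {x : ℝ | ∃ p : ℝ, ∃ ρZ : TwoQubit.Op 2 2, 0 ≤ p ∧ p < 1 ∧ TwoQubit.IsState ρZ ∧
        TwoQubit.IsSeparable ((1 - p) • ρ + p • ρZ) ∧ x = 1 / (2 * (1 - p))}
        (TwoQubit.Fstar ρ) ∧
      ∃ p : ℝ, IsLeast (TwoQubit.disentanglingWeights ρ) p ∧
        TwoQubit.Fstar ρ = 1 / (2 * (1 - p))) ∧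
    TwoQubit.IsEntanglementMeasure (1 / 2) TwoQubit.Fstar := by
  refine ⟨fun ρ hρ => ?_, TwoQubit.isEntanglementMeasure_Fstar⟩
  obtain ⟨Z, hZ, hΓ, hF, hach, hprimal⟩ := TwoQubit.exists_dual_optimal hρ
  obtain ⟨p, ρZ, hp0, hp1, hρZ, hsep, hFp⟩ := TwoQubit.exists_disentangling hρ
  refine ⟨hach, hprimal, ⟨⟨Z, hZ, hΓ, hF⟩, ?_⟩, ⟨⟨p, ρZ, hp0, hp1, hρZ, hsep, hFp⟩, ?_⟩,
    p, ⟨⟨hp0, hp1, ρZ, hρZ, hsep⟩, ?_⟩, hFp⟩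
  · rintro _ ⟨Y, hY, hYΓ, rfl⟩
    exact TwoQubit.Fstar_le hρ hY hYΓ
  · rintro _ ⟨q, σ, hq0, hq1, hσ, hqsep, rfl⟩
    exact TwoQubit.Fstar_le_of_isSeparable hρ hσ hq0 hq1 hqsep
  · rintro q ⟨hq0, hq1, σ, hσ, hqsep⟩
    -- As `1 / (2 (1 - p))` increases with `p` on `[0, 1)`, a least value gives a least weight.
    have h := TwoQubit.Fstar_le_of_isSeparable hρ hσ hq0 hq1 hqsep
    rw [hFp, one_div_le_one_div (by linarith) (by linarith)] at h
    linarith
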